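/- Let $r\ge 2$. For a finite set $I$ let $\mathcal R_I$ be the rose with petals $I$ (one vertex, one loop for each $i\in I$), and let a length function on it be $\ell=(\ell^i)_{i\in I}$ with all $\ell^i>0$. A based circuit is a non-empty sequence $(e_1,\dots,e_n)$ of directed edges with $e_{k}\ne\bar e_{k+1}$ for $1\le k<n$ and $e_n\neq\bar e_1$, where $\bar e$ denotes $e$ with its direction reversed. The entropy of $\ell$ is $\mathfrak h_I(\ell)=\lim_{t\to\infty}\frac1t\log\#\{\text{based circuits of }\ell\text{-length}\le t\}$. Let $\mathcal M^1(\mathcal R_I)=\{\ell\in(0,\infty)^I:\mathfrak h_I(\ell)=1\}$, with the entropy distance $$d_{\mathfrak h,\mathcal R_I}(x,y)=\inf_{\ell_t}\int_0^1\sqrt{\langle\dot\ell_t,\mathbf H[\mathfrak h_I(\ell_t)]\dot\ell_t\rangle}\,dt ,$$ where $\mathbf H$ is the Hessian matrix and the infimum is over the piecewise smooth paths $\ell_t\colon[0,1]\to\mathcal M^1(\mathcal R_I)$ from $x$ to $y$. Write $\mathcal R_r$ for $\mathcal R_{[r]}$, $[r]=\{1,\dots,r\}$, and let $\Delta^{r-1}=\{u\in[0,1]^r:\sum_i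 u_i=1\}$ be the standard $(r-1)$-simplex with vertex set $V$. **Theorem 1.2.** The limit defining $\mathfrak h_{[r]}(\ell)$ exists for every length function $\ell$ on $\mathcal R_r$, and $(\mathcal M^1(\mathcal R_r),d_{\mathfrak h,\mathcal R_r})$ is a metric space (with finite distances). There is a homeomorphism $\Phi$ from its metric completion onto $\Delta^{r-1}\setminus V$ such that 1. $\Phi$ maps $\mathcal M^1(\mathcal R_r)$ onto the interior $\{u\in \Delta^{r-1}: u_i>0\text{ for all }i\}$; 2. for every $S\subseteq[r]$ with $|S|\ge2$ there is a homeomorphism $\Psi_S$ from $\mathcal M^1(\mathcal R_S)$, with the topology of $d_{\mathfrak h,\mathcal R_S}$, onto the set of those points of the completion that $\Phi$ maps into the open face $\{u\in\Delta^{r-1}:u_i>0\iff i\in S\}$, such that for every $m\in\mathcal M^1(\mathcal R_S)$ a sequence $(x_n)$ in $\mathcal M^1(\mathcal R_r)$ converges in the completion to $\Psi_S(m)$ if and only if $x_n^i\to m^i$ for every $i\in S$ and $x_n^i\to\infty$ for every $i\notin S$. -/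

import Mathlib

open Set Filter Topology MeasureTheory
open scoped ENNReal ContDiff

noncomputable section

/-! ### Entropy of a length function on a rose

The rose with set of petals `ι` has one vertex and the directed edges `ι × Bool`, where `(i, !b)` is
the reverse of `(i, b)`.  Since there is only one vertex, every list of directed edges is an edge
path.  A length function assigns to each petal `i` its length `ℓ i > 0`. -/

/-- The length of an edge path in the rose. -/
def RosePathLength {ι : Type*} (ℓ : ι → ℝ) (w : List (ι × Bool)) : ℝ :=
  (w.map fun e => ℓ e.1).sum

/-- The based circuits of the rose: nonempty edge paths `(e₁, …, eₙ)` such that no `eₖ` is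
the reverse of `eₖ₊₁` and `eₙ` is not the reverse of `e₁`. -/
def RoseCircuits (ι : Type*) : Set (List (ι × Bool)) :=
  {w | w ≠ [] ∧ FreeGroup.IsCyclicallyReduced w}

/-- The number of based circuits of length at most `t`. -/
def roseCircuitCount {ι : Type*} (ℓ : ι → ℝ) (t : ℝ) : ℕ :=
  {w ∈ RoseCircuits ι | RosePathLength ℓ w ≤ t}.ncard

/-- The entropy `lim_{t → ∞} (1 / t) log #{circuits of length ≤ t}` of a length function. -/
def roseEntropy {ι : Type*} (ℓ : ι → ℝ) : ℝ :=
  limUnder atTop fun t : ℝ => 1 / t * Real.log (roseCircuitCount ℓ t)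

/-- `ℓ` is a length function (all lengths are positive) of entropy one. -/
def IsUnitEntropy {ι : Type*} (ℓ : ι → ℝ) : Prop :=
  (∀ i, 0 < ℓ i) ∧ roseEntropy ℓ = 1

/-- The moduli space `M¹` of unit entropy length functions on the rose with set of petals `ι`. -/
structure RoseModuli (ι : Type*) where
  /-- the length function -/
  len : ι → ℝ
  isUnitEntropy : IsUnitEntropy len

/-! ### The entropy metric -/

section Metric

variable {ι : Type*} [Fintype ι]

/-- The bilinear form `⟨v, H[𝔥(ℓ)] w⟩` given by the Hessian of the entropy function. -/
def entropyForm (ℓ v w : ι → ℝ) : ℝ :=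
  fderiv ℝ (fderiv ℝ (roseEntropy : (ι → ℝ) → ℝ)) ℓ v w

/-- The entropy norm of the vector `v` at `ℓ`. -/
def entropyNorm (ℓ v : ι → ℝ) : ℝ :=
  √(entropyForm ℓ v v)

/-- The entropy length of the restriction of `γ` to `s ⊆ ℝ`. -/
def entropyLengthOn (γ : ℝ → ι → ℝ) (s : Set ℝ) : ℝ≥0∞ :=
  ∫⁻ t in s, ENNReal.ofReal (entropyNorm (γ t) (deriv γ t))

/-- `γ` is smooth on each closed piece of a finite subdivision of `[0, 1]`
(in particular it is continuous on `[0, 1]`). -/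
def IsPiecewiseSmooth (γ : ℝ → ι → ℝ) : Prop :=
  ∃ P : Finset ℝ, ∀ a b : ℝ, 0 ≤ a → a < b → b ≤ 1 → (∀ p ∈ P, p ∉ Ioo a b) →
    ContDiffOn ℝ ∞ γ (Icc a b)

/-- `γ` restricted to `[0, 1]` is a piecewise smooth path from `x` to `y` in the moduli space. -/
structure IsModuliPath (x y : RoseModuli ι) (γ : ℝ → ι → ℝ) : Prop where
  smooth : IsPiecewiseSmooth γ
  mem : ∀ t ∈ Icc (0 : ℝ) 1, IsUnitEntropy (γ t)
  source : γ 0 = x.len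
  target : γ 1 = y.len

/-- The entropy distance: the infimum of the entropy lengths of piecewise smooth paths. -/
def entropyDist (x y : RoseModuli ι) : ℝ≥0∞ :=
  ⨅ (γ : ℝ → ι → ℝ) (_ : IsModuliPath x y γ), entropyLengthOn γ (Icc 0 1)

/-! The entropy distance satisfies the axioms of an (extended, pseudo-) metric. -/

theorem entropyNorm_smul (ℓ v : ι → ℝ) (c : ℝ) :
    entropyNorm ℓ (c • v) = |c| * entropyNorm ℓ v := by
  unfold entropyNorm entropyForm
  rw [map_smul, map_smul, smul_apply, smul_smul, smul_eq_mul,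
    Real.sqrt_mul (mul_self_nonneg c), Real.sqrt_mul_self_eq_abs]

theorem entropyLengthOn_affine (γ : ℝ → ι → ℝ) {s : Set ℝ} (hs : MeasurableSet s)
    {c : ℝ} (hc : c ≠ 0) (d : ℝ) :
    entropyLengthOn (fun t => γ (c * t + d)) s
      = entropyLengthOn γ ((fun t => c * t + d) '' s) := by
  unfold entropyLengthOn
  rw [lintegral_image_eq_lintegral_abs_deriv_mul (f' := fun _ => c) hs
    (fun x _ => by simpa using (((hasDerivAt_id x).const_mul c).add_const d).hasDerivWithinAt)
    (fun x _ y _ h => by simpa [hc] using h)]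
  refine lintegral_congr fun t => ?_
  have h : deriv (fun t => γ (c * t + d)) t = c • deriv γ (c * t + d) := by
    have h1 := deriv_comp_mul_left c (fun s => γ (s + d)) t
    rw [h1, deriv_comp_add_const]
  rw [h, entropyNorm_smul, ENNReal.ofReal_mul (abs_nonneg c)]

theorem contDiffOn_affine {γ : ℝ → ι → ℝ} {s u : Set ℝ} (h : ContDiffOn ℝ ∞ γ s) (c d : ℝ)
    (hm : MapsTo (fun t => c * t + d) u s) : ContDiffOn ℝ ∞ (fun t => γ (c * t + d)) u :=
  h.comp (by fun_prop) hm

theorem isModuliPath_const (x : RoseModuli ι) : IsModuliPath x x fun _ => x.len :=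
  ⟨⟨∅, fun _ _ _ _ _ _ => contDiffOn_const⟩, fun _ _ => x.isUnitEntropy, rfl, rfl⟩

theorem IsModuliPath.reverse {x y : RoseModuli ι} {γ : ℝ → ι → ℝ} (h : IsModuliPath x y γ) :
    IsModuliPath y x fun t => γ (-1 * t + 1) := by
  obtain ⟨⟨P, hP⟩, hm, h0, h1⟩ := h
  refine ⟨⟨P.image fun p => 1 - p, fun a b ha hab hb hd => ?_⟩, fun t ht => hm _ ?_, ?_, ?_⟩
  · refine contDiffOn_affine (hP (1 - b) (1 - a) (by linarith) (by linarith) (by linarith) ?_) _ _ ?_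
    · intro p hp hpm
      refine hd (1 - p) (Finset.mem_image_of_mem _ hp) ⟨?_, ?_⟩ <;> linarith [hpm.1, hpm.2]
    · rintro t ⟨h2, h3⟩
      constructor <;> linarith
  · constructor <;> linarith [ht.1, ht.2]
  · simpa using h1
  · simpa using h0

theorem IsModuliPath.trans {x y z : RoseModuli ι} {γ δ : ℝ → ι → ℝ} (h : IsModuliPath x y γ)
    (k : IsModuliPath y z δ) :
    IsModuliPath x z fun t => if t ≤ 1 / 2 then γ (2 * t + 0) else δ (2 * t + -1) := by
  obtain ⟨⟨P, hP⟩, hm, h0, h1⟩ := h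
  obtain ⟨⟨Q, hQ⟩, km, k0, k1⟩ := k
  refine ⟨⟨P.image (fun p => p / 2) ∪ Q.image (fun p => (p + 1) / 2) ∪ {1 / 2},
    fun a b ha hab hb hd => ?_⟩, fun t ht => ?_, ?_, ?_⟩
  · rcases le_or_gt b (1 / 2) with hb' | hb'
    · have := contDiffOn_affine (u := Icc a b)
        (hP (2 * a) (2 * b) (by linarith) (by linarith) (by linarith) ?_) 2 0 ?_
      · refine this.congr fun t ht => ?_
        rw [if_pos (ht.2.trans hb')]
      · intro p hp hpm
        refine hd (p / 2) (by simp [hp]) ⟨?_, ?_⟩ <;> linarith [hpm.1, hpm.2]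
      · rintro t ⟨h2, h3⟩
        constructor <;> linarith
    · have ha' : 1 / 2 ≤ a := by
        by_contra hlt
        exact hd (1 / 2) (by simp) ⟨not_le.mp hlt, hb'⟩
      have := contDiffOn_affine (u := Icc a b)
        (hQ (2 * a - 1) (2 * b - 1) (by linarith) (by linarith) (by linarith) ?_) 2 (-1) ?_
      · refine this.congr fun t ht => ?_
        split_ifs with hle
        · have : t = 1 / 2 := le_antisymm hle (ha'.trans ht.1)
          subst this
          norm_num [h1, k0]
        · rfl
      · intro p hp hpm
        refine hd ((p + 1) / 2) ?_ ⟨?_, ?_⟩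
        · exact Finset.mem_union_left _
            (Finset.mem_union_right _ (Finset.mem_image_of_mem (fun p => (p + 1) / 2) hp))
        all_goals linarith [hpm.1, hpm.2]
      · rintro t ⟨h2, h3⟩
        constructor <;> linarith
  · split_ifs with hle
    · exact hm _ ⟨by linarith [ht.1], by linarith⟩
    · exact km _ ⟨by linarith, by linarith [ht.2]⟩
  · norm_num [h0]
  · norm_num [k1]

theorem entropyLengthOn_trans_le (γ δ : ℝ → ι → ℝ) :
    entropyLengthOn (fun t => if t ≤ 1 / 2 then γ (2 * t + 0) else δ (2 * t + -1)) (Icc 0 1)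
      ≤ entropyLengthOn γ (Icc 0 1) + entropyLengthOn δ (Icc 0 1) := by
  set f : ℝ → ι → ℝ := fun t => if t ≤ 1 / 2 then γ (2 * t + 0) else δ (2 * t + -1) with hf
  have e1 : entropyLengthOn f (Icc 0 (1 / 2)) = entropyLengthOn γ (Icc 0 1) := by
    have : (fun t : ℝ => 2 * t + 0) '' Icc 0 (1 / 2) = Icc 0 1 := by
      rw [image_affine_Icc' (by norm_num)]; norm_num
    rw [← this, ← entropyLengthOn_affine γ measurableSet_Icc two_ne_zero]
    unfold entropyLengthOn
    rw [← restrict_Ioo_eq_restrict_Icc]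
    refine setLIntegral_congr_fun measurableSet_Ioo fun t ht => ?_
    have h : f =ᶠ[𝓝 t] fun t => γ (2 * t + 0) := by
      filter_upwards [Iio_mem_nhds ht.2] with s hs
      exact if_pos (le_of_lt hs)
    simp only [h.deriv_eq, h.eq_of_nhds]
  have e2 : entropyLengthOn f (Icc (1 / 2) 1) = entropyLengthOn δ (Icc 0 1) := by
    have : (fun t : ℝ => 2 * t + -1) '' Icc (1 / 2) 1 = Icc 0 1 := by
      rw [image_affine_Icc' (by norm_num)]; norm_num
    rw [← this, ← entropyLengthOn_affine δ measurableSet_Icc two_ne_zero]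
    unfold entropyLengthOn
    rw [← restrict_Ioo_eq_restrict_Icc]
    refine setLIntegral_congr_fun measurableSet_Ioo fun t ht => ?_
    have h : f =ᶠ[𝓝 t] fun t => δ (2 * t + -1) := by
      filter_upwards [Ioi_mem_nhds ht.1] with s hs
      exact if_neg (not_le.mpr hs)
    simp only [h.deriv_eq, h.eq_of_nhds]
  rw [← e1, ← e2]
  unfold entropyLengthOn
  rw [← Icc_union_Icc_eq_Icc (show (0 : ℝ) ≤ 1 / 2 by norm_num) (by norm_num)]
  exact lintegral_union_le _ _ _

theorem entropyDist_self (x : RoseModuli ι) : entropyDist x x = 0 := by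
  refine le_antisymm ((iInf₂_le _ (isModuliPath_const x)).trans ?_) zero_le
  simp [entropyLengthOn, entropyNorm, entropyForm]

theorem entropyDist_le_swap (x y : RoseModuli ι) : entropyDist x y ≤ entropyDist y x := by
  refine le_iInf₂ fun γ h => (iInf₂_le _ h.reverse).trans (le_of_eq ?_)
  rw [entropyLengthOn_affine γ measurableSet_Icc (by norm_num)]
  congr 1
  ext t
  simp only [mem_image, mem_Icc]
  constructor
  · rintro ⟨s, hs, rfl⟩
    constructor <;> linarith
  · intro ht
    exact ⟨1 - t, by constructor <;> linarith, by ring⟩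

theorem entropyDist_triangle (x y z : RoseModuli ι) :
    entropyDist x z ≤ entropyDist x y + entropyDist y z := by
  simp only [entropyDist]
  rw [ENNReal.iInf_add]
  refine le_iInf fun γ => ?_
  rw [ENNReal.iInf_add]
  refine le_iInf fun h => ?_
  rw [ENNReal.add_iInf]
  refine le_iInf fun δ => ?_
  rw [ENNReal.add_iInf]
  refine le_iInf fun k => ?_
  exact (iInf₂_le _ (h.trans k)).trans (entropyLengthOn_trans_le γ δ)

/-- The moduli space carries the entropy distance, and with it a uniformity and a topology. -/
instance : PseudoEMetricSpace (RoseModuli ι) where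
  edist := entropyDist
  edist_self := entropyDist_self
  edist_comm x y := le_antisymm (entropyDist_le_swap x y) (entropyDist_le_swap y x)
  edist_triangle := entropyDist_triangle

end Metric

/-- The completion of the moduli space of the rose for the entropy distance. -/
abbrev RoseModuliCompletion (ι : Type*) [Fintype ι] : Type _ :=
  UniformSpace.Completion (RoseModuli ι)

/-- The standard simplex with vertex set `ι` (of dimension `#ι - 1`), its vertices removed. -/
def simplexWithoutVertices (ι : Type*) [Fintype ι] [DecidableEq ι] : Set (ι → ℝ) :=
  stdSimplex ℝ ι \ range fun i => Pi.single i 1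

end

/-! The proof uses the weights `u i = petalWeight (ℓ i) = 2 / (exp (ℓ i) + 1)` as coordinates.
Reduced words are counted by the transfer matrix on directed edges, which has an explicit positive
eigenvector. It follows that the entropy of `ℓ` is the unique `s > 0` with `∑ i, petalWeight (s * ℓ
i) = 1` (`tendsto_log_roseCircuitCount`). So the moduli space is the open simplex `∑ i, u i = 1`, `u
i > 0`.

Differentiating this equation twice gives the Hessian on tangent vectors (`entropyForm_eq`). If the
weights move with velocity `w`, the form is `∑ i, 2 (1 - u i) / (u i (2 - u i)) * w i ^ 2`, divided
by the slope `D = ∑ i, u i (2 - u i) / 2 * ℓ i`.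

Away from the vertices `D` is bounded below and the numerator is at most `∑ i, w i ^ 2 / u i`. The
singularity at `u i = 0` is then integrable along segments, so the open faces lie at finite distance
(`exists_edist_le`). Near the vertex `u i = 1` put `ε = 1 - u i`. The tangency condition makes the
numerator at least `w i ^ 2 / (4 ε)`, while `D = O(ε log (1 / ε))`. The norm therefore dominates a
multiple of `|dε| / (ε √(log (1 / ε)))`, whose integral diverges: the vertices are at infinite
distance (`lipschitzWith_petalHeight`).

Hence Cauchy filters have weights converging to a point of the simplex other than a vertex
(`exists_tendsto_weight`), and the neighbourhoods of every such point pull back to a Cauchy filter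
(`cauchy_comap_weight`). By `exists_completion_homeomorph` this identifies the completion. A weight
tends to `0` exactly when the length tends to infinity, and on the face of `S` the equation `∑ u i =
1` is that of the subrose, which gives the strata. -/

noncomputable section

/-- Each petal of length `x` contributes `petalWeight x` to the sum that equals one exactly
for the length functions of entropy one. -/
def petalWeight (x : ℝ) : ℝ := 2 / (Real.exp x + 1)

/-! ### Counting reduced words with the transfer matrix. -/

section Counting

variable {ι : Type*}

/-- The words that continue the letter `e` to a reduced word whose last letter satisfies `Q`
and that have length at most `t`. -/
def roseTails (ℓ : ι → ℝ) (Q : ι × Bool → Prop) (e : ι × Bool) (t : ℝ) :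
    Set (List (ι × Bool)) :=
  {w | FreeGroup.IsReduced (e :: w) ∧ (∀ a ∈ (e :: w).getLast?, Q a) ∧ RosePathLength ℓ w ≤ t}

theorem rosePathLength_cons (ℓ : ι → ℝ) (e : ι × Bool) (w : List (ι × Bool)) :
    RosePathLength ℓ (e :: w) = ℓ e.1 + RosePathLength ℓ w := by
  simp [RosePathLength]

theorem length_mul_le_rosePathLength {ℓ : ι → ℝ} {m : ℝ} (hm : ∀ i, m ≤ ℓ i)
    (w : List (ι × Bool)) : w.length * m ≤ RosePathLength ℓ w := by
  induction w with
  | nil => simp [RosePathLength]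
  | cons e w ih =>
    rw [rosePathLength_cons, List.length_cons]
    push_cast
    linarith [hm e.1]

theorem rosePathLength_nonneg {ℓ : ι → ℝ} (hℓ : ∀ i, 0 < ℓ i) (w : List (ι × Bool)) :
    0 ≤ RosePathLength ℓ w := by
  simpa using length_mul_le_rosePathLength (fun i => (hℓ i).le) w

theorem cons_mem_roseTails {ℓ : ι → ℝ} {Q : ι × Bool → Prop} {e f : ι × Bool} {t : ℝ}
    {w : List (ι × Bool)} :
    f :: w ∈ roseTails ℓ Q e t ↔ f ≠ (e.1, !e.2) ∧ w ∈ roseTails ℓ Q f (t - ℓ f.1) := by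
  have h : (e.1 = f.1 → e.2 = f.2) ↔ f ≠ (e.1, !e.2) := by
    rcases e with ⟨i, b⟩
    rcases f with ⟨j, c⟩
    cases b <;> cases c <;> simp [eq_comm]
  simp only [roseTails, mem_ofPred_eq, FreeGroup.IsReduced.eq_1, List.isChain_cons_cons, h,
    rosePathLength_cons, List.getLast?_cons_cons, le_sub_iff_add_le', and_assoc]

theorem exists_pos_le [Finite ι] {ℓ : ι → ℝ} (hℓ : ∀ i, 0 < ℓ i) : ∃ m > 0, ∀ i, m ≤ ℓ i := by
  rcases isEmpty_or_nonempty ι with h | h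
  · exact ⟨1, one_pos, fun i => h.elim i⟩
  · obtain ⟨i, hi⟩ := Finite.exists_min ℓ
    exact ⟨ℓ i, hℓ i, hi⟩

theorem finite_rosePathLength_le [Finite ι] {ℓ : ι → ℝ} (hℓ : ∀ i, 0 < ℓ i) (t : ℝ) :
    {w : List (ι × Bool) | RosePathLength ℓ w ≤ t}.Finite := by
  obtain ⟨m, hm, h⟩ := exists_pos_le hℓ
  refine (List.finite_length_le (ι × Bool) ⌊t / m⌋₊).subset fun w hw => ?_
  exact Nat.le_floor ((le_div_iff₀ hm).2 ((length_mul_le_rosePathLength h w).trans hw))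

theorem finite_roseTails [Finite ι] {ℓ : ι → ℝ} (hℓ : ∀ i, 0 < ℓ i) (Q : ι × Bool → Prop)
    (e : ι × Bool) (t : ℝ) : (roseTails ℓ Q e t).Finite :=
  (finite_rosePathLength_le hℓ t).subset fun _ hw => hw.2.2

theorem ncard_roseTails_of_neg {ℓ : ι → ℝ} (hℓ : ∀ i, 0 < ℓ i) (Q : ι × Bool → Prop)
    (e : ι × Bool) {t : ℝ} (ht : t < 0) : (roseTails ℓ Q e t).ncard = 0 := by
  have : roseTails ℓ Q e t = ∅ := by
    ext w
    simp only [mem_empty_iff_false, iff_false]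
    exact fun hw => absurd hw.2.2 (not_le.2 (ht.trans_le (rosePathLength_nonneg hℓ w)))
  simp [this]

/-- The entries of the Perron vector of the transfer matrix of the rose. -/
def perronEntry (ℓ : ι → ℝ) (s : ℝ) (e : ι × Bool) : ℝ := 1 / (1 + Real.exp (-(s * ℓ e.1)))

theorem perronEntry_pos (ℓ : ι → ℝ) (s : ℝ) (e : ι × Bool) : 0 < perronEntry ℓ s e := by
  unfold perronEntry
  positivity

theorem perronEntry_le_one (ℓ : ι → ℝ) (s : ℝ) (e : ι × Bool) : perronEntry ℓ s e ≤ 1 := by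
  unfold perronEntry
  rw [div_le_one (by positivity)]
  linarith [Real.exp_pos (-(s * ℓ e.1))]

/-- The letters that may precede `e` in a reduced word. -/
def rosePrecedes (e a : ι × Bool) : Prop := a.1 = e.1 → a.2 = e.2

/-- The predicate `Q` of `roseTails` absorbs the cyclic condition between the last and the first
letter, so circuits obey the same recursion as reduced words. -/
theorem cons_mem_roseCircuits {ℓ : ι → ℝ} {e : ι × Bool} {w : List (ι × Bool)} {t : ℝ} :
    e :: w ∈ {w ∈ RoseCircuits ι | RosePathLength ℓ w ≤ t} ↔
      w ∈ roseTails ℓ (rosePrecedes e) e (t - ℓ e.1) := by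
  simp only [RoseCircuits, FreeGroup.isCyclicallyReduced_iff, roseTails, mem_ofPred_eq,
    rosePathLength_cons, rosePrecedes, List.head?_cons, Option.mem_some_iff, forall_eq',
    le_sub_iff_add_le', and_assoc]
  simp

theorem le_roseCircuitCount [Finite ι] {ℓ : ι → ℝ} (hℓ : ∀ i, 0 < ℓ i) (e : ι × Bool) (t : ℝ) :
    (roseTails ℓ (rosePrecedes e) e (t - ℓ e.1)).ncard ≤ roseCircuitCount ℓ t := by
  rw [roseCircuitCount, ← Set.ncard_image_of_injective _ (List.cons_injective (a := e))]
  refine Set.ncard_le_ncard ?_ ((finite_rosePathLength_le hℓ t).subset fun _ hw => hw.2)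
  rintro _ ⟨w, hw, rfl⟩
  exact cons_mem_roseCircuits.2 hw

variable [Fintype ι] [DecidableEq ι]

/-- The letters that may follow `e` in a reduced word. -/
def roseSuccessors (e : ι × Bool) : Finset (ι × Bool) := Finset.univ.erase (e.1, !e.2)

theorem sum_ncard_roseTails_le {ℓ : ι → ℝ} (hℓ : ∀ i, 0 < ℓ i) (Q : ι × Bool → Prop)
    (e : ι × Bool) (t : ℝ) :
    ∑ f ∈ roseSuccessors e, (roseTails ℓ Q f (t - ℓ f.1)).ncard ≤ (roseTails ℓ Q e t).ncard := by
  have hfin := finite_roseTails hℓ Q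
  rw [Set.ncard_eq_toFinset_card _ (hfin e t)]
  calc ∑ f ∈ roseSuccessors e, (roseTails ℓ Q f (t - ℓ f.1)).ncard
      = ((roseSuccessors e).biUnion fun f =>
          (hfin f (t - ℓ f.1)).toFinset.image (List.cons f)).card := by
        rw [Finset.card_biUnion]
        · refine Finset.sum_congr rfl fun f _ => ?_
          rw [Finset.card_image_of_injective _ List.cons_injective,
            Set.ncard_eq_toFinset_card _ (hfin f _)]
        · intro f _ f' _ hne
          rw [Function.onFun, Finset.disjoint_left]
          intro w hw hw'
          obtain ⟨a, _, rfl⟩ := Finset.mem_image.1 hw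
          obtain ⟨b, _, hb⟩ := Finset.mem_image.1 hw'
          exact hne (List.cons.inj hb).1.symm
    _ ≤ _ := by
        refine Finset.card_le_card fun w hw => ?_
        obtain ⟨f, hf, hw⟩ := Finset.mem_biUnion.1 hw
        obtain ⟨a, ha, rfl⟩ := Finset.mem_image.1 hw
        rw [Set.Finite.mem_toFinset] at ha ⊢
        exact cons_mem_roseTails.2 ⟨(Finset.mem_erase.1 hf).1, ha⟩

/-- The summand `1` accounts for the empty tail, which the lower bound `sum_ncard_roseTails_le`
drops. -/
theorem ncard_roseTails_le {ℓ : ι → ℝ} (hℓ : ∀ i, 0 < ℓ i) (Q : ι × Bool → Prop)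
    (e : ι × Bool) (t : ℝ) :
    (roseTails ℓ Q e t).ncard
      ≤ 1 + ∑ f ∈ roseSuccessors e, (roseTails ℓ Q f (t - ℓ f.1)).ncard := by
  have hfin := finite_roseTails hℓ Q
  rw [Set.ncard_eq_toFinset_card _ (hfin e t)]
  calc (hfin e t).toFinset.card
      ≤ ({[]} ∪ (roseSuccessors e).biUnion fun f =>
          (hfin f (t - ℓ f.1)).toFinset.image (List.cons f)).card := by
        refine Finset.card_le_card fun w hw => ?_
        rw [Set.Finite.mem_toFinset] at hw
        cases w with
        | nil => simp
        | cons f w =>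
          obtain ⟨h1, h2⟩ := cons_mem_roseTails.1 hw
          refine Finset.mem_union_right _ (Finset.mem_biUnion.2 ⟨f, ?_, ?_⟩)
          · exact Finset.mem_erase.2 ⟨h1, Finset.mem_univ _⟩
          · exact Finset.mem_image_of_mem _ (by rwa [Set.Finite.mem_toFinset])
    _ ≤ 1 + ∑ f ∈ roseSuccessors e, ((hfin f (t - ℓ f.1)).toFinset.image (List.cons f)).card :=
        (Finset.card_union_le _ _).trans (by simpa using Finset.card_biUnion_le)
    _ = _ := by
        congr 1
        refine Finset.sum_congr rfl fun f _ => ?_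
        rw [Finset.card_image_of_injective _ List.cons_injective,
          Set.ncard_eq_toFinset_card _ (hfin f _)]

/-- The transfer matrix acts on the vector `perronEntry`. When the weights sum to one, the vector is
fixed; when they sum to less than one, the deficit is a strict gain at every letter. -/
theorem sum_successors_perronEntry (ℓ : ι → ℝ) (s t : ℝ) (e : ι × Bool) :
    ∑ f ∈ roseSuccessors e, perronEntry ℓ s f * Real.exp (s * (t - ℓ f.1))
      = (∑ i, petalWeight (s * ℓ i) - 1 + perronEntry ℓ s e) * Real.exp (s * t) := by
  have h1 : ∀ f : ι × Bool, perronEntry ℓ s f * Real.exp (s * (t - ℓ f.1))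
      = petalWeight (s * ℓ f.1) / 2 * Real.exp (s * t) := by
    intro f
    unfold perronEntry petalWeight
    rw [mul_sub, Real.exp_sub, Real.exp_neg]
    field_simp
  have h2 : petalWeight (s * ℓ e.1) / 2 = 1 - perronEntry ℓ s e := by
    unfold perronEntry petalWeight
    rw [Real.exp_neg]
    field_simp
    ring
  have h3 : ∑ f : ι × Bool, petalWeight (s * ℓ f.1) / 2 = ∑ i, petalWeight (s * ℓ i) := by
    rw [Fintype.sum_prod_type]
    refine Finset.sum_congr rfl fun i _ => ?_
    simp
    ring
  rw [roseSuccessors, Finset.sum_congr rfl fun f _ => h1 f,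
    ← Finset.sum_mul, Finset.sum_erase_eq_sub (Finset.mem_univ _), h2, h3]
  ring

/-- The function `C * perronEntry * exp (s * t)` is a supersolution of the counting recursion: the
deficit `1 - V` times `C` is one, which pays for the empty tail. -/
theorem exists_ncard_roseTails_le {ℓ : ι → ℝ} (hℓ : ∀ i, 0 < ℓ i) (Q : ι × Bool → Prop) {s : ℝ}
    (hs : 0 ≤ s) (hV : ∑ i, petalWeight (s * ℓ i) < 1) :
    ∃ C > 0, ∀ e t, ((roseTails ℓ Q e t).ncard : ℝ) ≤ C * Real.exp (s * t) := by
  set V := ∑ i, petalWeight (s * ℓ i) with hVdef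
  have hV' : 0 < 1 - V := by linarith
  set C := 1 / (1 - V) with hC
  have hCpos : 0 < C := by positivity
  have hCV : C * (1 - V) = 1 := by rw [hC]; field_simp
  obtain ⟨m, hm, hml⟩ := exists_pos_le hℓ
  -- Induction on the real variable `t` in steps of the least petal length `m`, since removing a
  -- letter lowers `t` by at least `m`.
  have key : ∀ n : ℕ, ∀ e t, t < n * m →
      ((roseTails ℓ Q e t).ncard : ℝ) ≤ C * (perronEntry ℓ s e * Real.exp (s * t)) := by
    intro n
    induction n with
    | zero =>
      intro e t ht
      have := perronEntry_pos ℓ s e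
      rw [ncard_roseTails_of_neg hℓ Q e (by simpa using ht)]
      simp only [Nat.cast_zero]
      positivity
    | succ n ih =>
      intro e t ht
      rcases lt_or_ge t 0 with h0 | h0
      · have := perronEntry_pos ℓ s e
        rw [ncard_roseTails_of_neg hℓ Q e h0]
        simp only [Nat.cast_zero]
        positivity
      have hexp : 1 ≤ Real.exp (s * t) := Real.one_le_exp (by positivity)
      calc ((roseTails ℓ Q e t).ncard : ℝ)
          ≤ 1 + ∑ f ∈ roseSuccessors e, ((roseTails ℓ Q f (t - ℓ f.1)).ncard : ℝ) := by
            exact_mod_cast ncard_roseTails_le hℓ Q e t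
        _ ≤ 1 + ∑ f ∈ roseSuccessors e, C * (perronEntry ℓ s f * Real.exp (s * (t - ℓ f.1))) := by
            gcongr with f _
            refine ih f _ ?_
            push_cast at ht
            linarith [hml f.1]
        _ = 1 + C * ((V - 1 + perronEntry ℓ s e) * Real.exp (s * t)) := by
            rw [← Finset.mul_sum, sum_successors_perronEntry]
        _ = C * (perronEntry ℓ s e * Real.exp (s * t)) + (1 - Real.exp (s * t)) := by
            linear_combination (-Real.exp (s * t)) * hCV
        _ ≤ _ := by linarith
  refine ⟨C, hCpos, fun e t => ?_⟩
  obtain ⟨n, hn⟩ := exists_nat_gt (t / m)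
  refine (key n e t ((div_lt_iff₀ hm).1 hn)).trans ?_
  have := mul_le_mul_of_nonneg_right (perronEntry_le_one ℓ s e) (Real.exp_pos (s * t)).le
  rw [one_mul] at this
  gcongr

/-- If the empty tail violates the cyclic condition, then `e` lies on the petal of `e₀`, and one
letter on any other petal repairs this. -/
theorem one_le_ncard_roseTails [Nontrivial ι] {ℓ : ι → ℝ} (hℓ : ∀ i, 0 < ℓ i) (e₀ e : ι × Bool)
    {t : ℝ} (ht : ∀ i, ℓ i ≤ t) : 1 ≤ (roseTails ℓ (rosePrecedes e₀) e t).ncard := by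
  rw [Nat.one_le_iff_ne_zero, ← Nat.pos_iff_ne_zero, Set.ncard_pos (finite_roseTails hℓ _ _ _)]
  by_cases h : rosePrecedes e₀ e
  · refine ⟨[], by simp, by simpa using h, ?_⟩
    have := (hℓ e.1).le.trans (ht e.1)
    simpa [RosePathLength] using this
  · have he : e.1 = e₀.1 := by
      by_contra hne
      exact h fun h => (hne h).elim
    obtain ⟨j, hj⟩ := exists_ne e.1
    refine ⟨[(j, true)], ?_, ?_, ?_⟩
    · rw [FreeGroup.IsReduced.eq_1, List.isChain_cons_cons]
      exact ⟨fun h => (hj h.symm).elim, by simp⟩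
    · simp only [List.getLast?_cons_cons, List.getLast?_singleton, Option.mem_some_iff,
        forall_eq']
      exact fun h => (hj (h.trans he.symm)).elim
    · simpa [RosePathLength] using ht j

/-- For weights of sum one the Perron vector gives an exact solution of the recursion without the
empty tail, so a lower bound on an initial window propagates. -/
theorem exists_le_ncard_roseTails [Nontrivial ι] {ℓ : ι → ℝ} (hℓ : ∀ i, 0 < ℓ i)
    (e₀ : ι × Bool) {s : ℝ} (hs : 0 ≤ s) (hV : ∑ i, petalWeight (s * ℓ i) = 1) :
    ∃ c > 0, ∃ L : ℝ, ∀ e, ∀ t ≥ L,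
      c * Real.exp (s * t) ≤ (roseTails ℓ (rosePrecedes e₀) e t).ncard := by
  obtain ⟨m, hm, hml⟩ := exists_pos_le hℓ
  -- The window is `[L, 2 * L]`: as `L` exceeds every petal length, `t - ℓ f.1` stays above `L` once
  -- `t ≥ 2 * L`. The constant `c` makes the claimed bound at most one on the window.
  set L := ∑ i, ℓ i with hL
  have hℓL : ∀ i, ℓ i ≤ L := fun i =>
    Finset.single_le_sum (f := ℓ) (fun j _ => (hℓ j).le) (Finset.mem_univ i)
  set c := Real.exp (-(s * (2 * L))) with hc
  have key : ∀ n : ℕ, ∀ e t, L ≤ t → t < 2 * L + n * m →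
      c * (perronEntry ℓ s e * Real.exp (s * t))
        ≤ (roseTails ℓ (rosePrecedes e₀) e t).ncard := by
    have base : ∀ e t, L ≤ t → t ≤ 2 * L → c * (perronEntry ℓ s e * Real.exp (s * t))
        ≤ (roseTails ℓ (rosePrecedes e₀) e t).ncard := by
      intro e t h1 h2
      calc c * (perronEntry ℓ s e * Real.exp (s * t))
          ≤ c * (1 * Real.exp (s * (2 * L))) := by
            gcongr
            exact perronEntry_le_one ℓ s e
        _ = 1 := by rw [hc, one_mul, ← Real.exp_add]; simp
        _ ≤ _ := by
            exact_mod_cast one_le_ncard_roseTails hℓ e₀ e fun i => (hℓL i).trans h1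
    intro n
    induction n with
    | zero => exact fun e t h1 h2 => base e t h1 (by simpa using h2.le)
    | succ n ih =>
      intro e t h1 h2
      rcases le_total t (2 * L) with h | h
      · exact base e t h1 h
      calc c * (perronEntry ℓ s e * Real.exp (s * t))
          = ∑ f ∈ roseSuccessors e, c * (perronEntry ℓ s f * Real.exp (s * (t - ℓ f.1))) := by
            rw [← Finset.mul_sum, sum_successors_perronEntry, hV]
            ring
        _ ≤ ∑ f ∈ roseSuccessors e,
              ((roseTails ℓ (rosePrecedes e₀) f (t - ℓ f.1)).ncard : ℝ) := by
            gcongr with f _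
            push_cast at h2
            exact ih f _ (by linarith [hℓL f.1]) (by linarith [hml f.1])
        _ ≤ _ := by exact_mod_cast sum_ncard_roseTails_le hℓ _ e t
  -- The factor `1 / 2` is the lower bound for the Perron entries.
  refine ⟨c / 2, by positivity, L, fun e t ht => ?_⟩
  obtain ⟨n, hn⟩ := exists_nat_gt ((t - 2 * L) / m)
  refine le_trans ?_ (key n e t ht (by linarith [(div_lt_iff₀ hm).1 hn]))
  have h1 : 1 / 2 ≤ perronEntry ℓ s e := by
    unfold perronEntry
    gcongr
    have : Real.exp (-(s * ℓ e.1)) ≤ 1 := Real.exp_le_one_iff.2 (by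
      have := mul_nonneg hs (hℓ e.1).le
      linarith)
    linarith
  calc c / 2 * Real.exp (s * t) = c * (1 / 2 * Real.exp (s * t)) := by ring
    _ ≤ _ := by gcongr

theorem roseCircuitCount_le {ℓ : ι → ℝ} (hℓ : ∀ i, 0 < ℓ i) (t : ℝ) :
    roseCircuitCount ℓ t ≤ ∑ e, (roseTails ℓ (rosePrecedes e) e (t - ℓ e.1)).ncard := by
  have hfin := finite_roseTails hℓ
  have hfin' : {w ∈ RoseCircuits ι | RosePathLength ℓ w ≤ t}.Finite :=
    (finite_rosePathLength_le hℓ t).subset fun _ hw => hw.2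
  rw [roseCircuitCount, Set.ncard_eq_toFinset_card _ hfin']
  calc hfin'.toFinset.card
      ≤ (Finset.univ.biUnion fun e =>
          (hfin (rosePrecedes e) e (t - ℓ e.1)).toFinset.image (List.cons e)).card := by
        refine Finset.card_le_card fun w hw => ?_
        rw [Set.Finite.mem_toFinset] at hw
        cases w with
        | nil => exact absurd rfl hw.1.1
        | cons e w =>
          refine Finset.mem_biUnion.2 ⟨e, Finset.mem_univ _, Finset.mem_image_of_mem _ ?_⟩
          rw [Set.Finite.mem_toFinset]
          exact cons_mem_roseCircuits.1 hw
    _ ≤ _ := Finset.card_biUnion_le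
    _ = _ := by
        refine Finset.sum_congr rfl fun f _ => ?_
        rw [Finset.card_image_of_injective _ List.cons_injective,
          Set.ncard_eq_toFinset_card _ (hfin _ f _)]

end Counting

/-! ### Calculus of the weight function. -/

theorem petalWeight_pos (x : ℝ) : 0 < petalWeight x := by
  unfold petalWeight
  positivity

theorem petalWeight_lt_two (x : ℝ) : petalWeight x < 2 := by
  unfold petalWeight
  rw [div_lt_iff₀ (by positivity)]
  linarith [Real.exp_pos x]

theorem strictAnti_petalWeight : StrictAnti petalWeight := fun x y h => by
  unfold petalWeight
  gcongr

theorem petalWeight_zero : petalWeight 0 = 1 := by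
  norm_num [petalWeight]

theorem petalWeight_lt_one {x : ℝ} (hx : 0 < x) : petalWeight x < 1 :=
  petalWeight_zero ▸ strictAnti_petalWeight hx

theorem contDiff_petalWeight {n : WithTop ℕ∞} : ContDiff ℝ n petalWeight := by
  unfold petalWeight
  exact contDiff_const.div (Real.contDiff_exp.add contDiff_const) fun x => by positivity

theorem continuous_petalWeight : Continuous petalWeight :=
  (contDiff_petalWeight (n := 0)).continuous

theorem tendsto_petalWeight_atTop : Tendsto petalWeight atTop (𝓝 0) :=
  tendsto_const_nhds.div_atTop (tendsto_atTop_add_const_right _ _ Real.tendsto_exp_atTop)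

/-- The derivative of `petalWeight`. -/
def petalWeightDeriv (x : ℝ) : ℝ := -(petalWeight x * (2 - petalWeight x) / 2)

/-- The second derivative of `petalWeight`. -/
def petalWeightDeriv₂ (x : ℝ) : ℝ :=
  petalWeight x * (1 - petalWeight x) * (2 - petalWeight x) / 2

theorem hasDerivAt_petalWeight (x : ℝ) : HasDerivAt petalWeight (petalWeightDeriv x) x := by
  have h := ((Real.hasDerivAt_exp x).add_const 1).inv (by positivity) |>.const_mul 2
  refine (h.congr_deriv ?_).congr_of_eventuallyEq (Eventually.of_forall fun y => ?_)
  · unfold petalWeightDeriv petalWeight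
    field_simp
    ring
  · simp [petalWeight, div_eq_mul_inv]

theorem hasDerivAt_petalWeightDeriv (x : ℝ) :
    HasDerivAt petalWeightDeriv (petalWeightDeriv₂ x) x := by
  have h := hasDerivAt_petalWeight x
  refine (((h.mul (h.const_sub 2)).div_const 2).neg).congr_deriv ?_
  unfold petalWeightDeriv₂ petalWeightDeriv
  ring

theorem petalWeightDeriv_neg (x : ℝ) : petalWeightDeriv x < 0 := by
  have h := sub_pos.2 (petalWeight_lt_two x)
  have := petalWeight_pos x
  unfold petalWeightDeriv
  have : 0 < petalWeight x * (2 - petalWeight x) := by positivity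
  linarith

theorem petalWeightDeriv₂_nonneg {x : ℝ} (hx : 0 < x) : 0 ≤ petalWeightDeriv₂ x := by
  have h1 := petalWeight_pos x
  have h2 := petalWeight_lt_one hx
  have h3 : 0 < 1 - petalWeight x := by linarith
  have h4 : 0 < 2 - petalWeight x := by linarith
  unfold petalWeightDeriv₂
  positivity

/-! ### The entropy as an implicit function -/

section Entropy

variable {ι : Type*} [Fintype ι]

theorem strictAnti_sum_petalWeight [Nonempty ι] {ℓ : ι → ℝ} (hℓ : ∀ i, 0 < ℓ i) :
    StrictAnti fun s : ℝ => ∑ i, petalWeight (s * ℓ i) := fun _ _ h =>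
  Finset.sum_lt_sum_of_nonempty Finset.univ_nonempty fun i _ =>
    strictAnti_petalWeight (mul_lt_mul_of_pos_right h (hℓ i))

/-- Intermediate value theorem: the sum is the number of petals at `s = 0` and tends to zero at
infinity. -/
theorem exists_sum_petalWeight_eq_one [Nontrivial ι] {ℓ : ι → ℝ} (hℓ : ∀ i, 0 < ℓ i) :
    ∃ s > 0, ∑ i, petalWeight (s * ℓ i) = 1 := by
  have hcont : Continuous fun s : ℝ => ∑ i, petalWeight (s * ℓ i) :=
    continuous_finsetSum _ fun i _ => continuous_petalWeight.comp (by fun_prop)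
  have hlim : Tendsto (fun s : ℝ => ∑ i, petalWeight (s * ℓ i)) atTop (𝓝 0) := by
    have : Tendsto (fun s : ℝ => ∑ i, petalWeight (s * ℓ i)) atTop (𝓝 (∑ _i : ι, 0)) :=
      tendsto_finsetSum _ fun i _ =>
        tendsto_petalWeight_atTop.comp (tendsto_id.atTop_mul_const (hℓ i))
    simpa using this
  have h0 : 1 < ∑ i, petalWeight (0 * ℓ i) := by
    simp only [zero_mul, petalWeight_zero, Finset.sum_const, Finset.card_univ, nsmul_eq_mul,
      mul_one]
    exact_mod_cast Fintype.one_lt_card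
  obtain ⟨T, hT, hT0⟩ := ((hlim.eventually (gt_mem_nhds one_pos)).and
    (eventually_ge_atTop 0)).exists
  obtain ⟨s, hs, hs1⟩ := intermediate_value_Icc' hT0 hcont.continuousOn ⟨hT.le, h0.le⟩
  refine ⟨s, lt_of_le_of_ne hs.1 ?_, hs1⟩
  rintro rfl
  exact h0.ne' hs1

/-- The lower bound holds at the rate `h` itself; the upper bound is available only for rates `s >
h`, where the weights sum to less than one, and this suffices for the limit. -/
theorem tendsto_log_roseCircuitCount [Nontrivial ι] {ℓ : ι → ℝ} (hℓ : ∀ i, 0 < ℓ i) {h : ℝ}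
    (hpos : 0 < h) (hsum : ∑ i, petalWeight (h * ℓ i) = 1) :
    Tendsto (fun t : ℝ => 1 / t * Real.log (roseCircuitCount ℓ t)) atTop (𝓝 h) := by
  classical
  obtain ⟨i₀⟩ : Nonempty ι := inferInstance
  set e₀ : ι × Bool := (i₀, true)
  obtain ⟨c, hc, L, hcL⟩ := exists_le_ncard_roseTails hℓ e₀ hpos.le hsum
  have lower : ∀ᶠ t in atTop, c * Real.exp (-(h * ℓ i₀)) * Real.exp (h * t)
      ≤ roseCircuitCount ℓ t := by
    filter_upwards [eventually_ge_atTop (L + ℓ i₀)] with t ht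
    refine le_trans (le_of_eq ?_) ((hcL e₀ (t - ℓ i₀) (by linarith)).trans
      (by exact_mod_cast le_roseCircuitCount hℓ e₀ t))
    rw [mul_assoc, ← Real.exp_add]
    ring_nf
  have aux : ∀ (C s : ℝ), 0 < C → Tendsto (fun t : ℝ => 1 / t * Real.log (C * Real.exp (s * t)))
      atTop (𝓝 s) := by
    intro C s hC
    have h1 : Tendsto (fun t : ℝ => Real.log C / t + s) atTop (𝓝 (0 + s)) :=
      (tendsto_const_nhds.div_atTop tendsto_id).add_const s
    rw [zero_add] at h1
    refine h1.congr' ?_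
    filter_upwards [eventually_gt_atTop 0] with t ht
    rw [Real.log_mul hC.ne' (Real.exp_pos _).ne', Real.log_exp]
    field_simp
  refine tendsto_order.2 ⟨fun a ha => ?_, fun b hb => ?_⟩
  · filter_upwards [lower, eventually_gt_atTop 0, (aux _ h (by positivity :
      0 < c * Real.exp (-(h * ℓ i₀)))).eventually (lt_mem_nhds ha)] with t h1 h2 h3
    refine h3.trans_le ?_
    gcongr
  · obtain ⟨s, hs, hsb⟩ := exists_between hb
    have hV : ∑ i, petalWeight (s * ℓ i) < 1 := hsum ▸ strictAnti_sum_petalWeight hℓ hs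
    choose C hC hCt using fun e : ι × Bool =>
      exists_ncard_roseTails_le hℓ (rosePrecedes e) (hpos.trans hs).le hV
    have hCpos : 0 < ∑ e, C e := Finset.sum_pos (fun e _ => hC e) ⟨e₀, Finset.mem_univ _⟩
    filter_upwards [lower, eventually_gt_atTop 0,
      (aux _ s hCpos).eventually (gt_mem_nhds hsb)] with t h1 h2 h3
    refine lt_of_le_of_lt ?_ h3
    have h4 : 0 < (roseCircuitCount ℓ t : ℝ) := lt_of_lt_of_le (by positivity) h1
    gcongr
    calc (roseCircuitCount ℓ t : ℝ)
        ≤ ∑ e, ((roseTails ℓ (rosePrecedes e) e (t - ℓ e.1)).ncard : ℝ) := by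
          exact_mod_cast roseCircuitCount_le hℓ t
      _ ≤ ∑ e, C e * Real.exp (s * t) := by
          refine Finset.sum_le_sum fun e _ => (hCt e e _).trans ?_
          have := hℓ e.1
          have := hC e
          have := hpos.trans hs
          gcongr
          linarith
      _ = _ := by rw [Finset.sum_mul]

theorem roseEntropy_eq [Nontrivial ι] {ℓ : ι → ℝ} (hℓ : ∀ i, 0 < ℓ i) {h : ℝ}
    (hpos : 0 < h) (hsum : ∑ i, petalWeight (h * ℓ i) = 1) : roseEntropy ℓ = h :=
  (tendsto_log_roseCircuitCount hℓ hpos hsum).limUnder_eq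

theorem roseEntropy_spec [Nontrivial ι] {ℓ : ι → ℝ} (hℓ : ∀ i, 0 < ℓ i) :
    0 < roseEntropy ℓ ∧ ∑ i, petalWeight (roseEntropy ℓ * ℓ i) = 1 := by
  obtain ⟨s, hs, h⟩ := exists_sum_petalWeight_eq_one hℓ
  rw [roseEntropy_eq hℓ hs h]
  exact ⟨hs, h⟩

theorem tendsto_roseEntropy [Nontrivial ι] {ℓ : ι → ℝ} (hℓ : ∀ i, 0 < ℓ i) :
    Tendsto (fun t : ℝ => 1 / t * Real.log (roseCircuitCount ℓ t)) atTop (𝓝 (roseEntropy ℓ)) :=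
  tendsto_log_roseCircuitCount hℓ (roseEntropy_spec hℓ).1 (roseEntropy_spec hℓ).2

theorem isUnitEntropy_iff [Nontrivial ι] {ℓ : ι → ℝ} :
    IsUnitEntropy ℓ ↔ (∀ i, 0 < ℓ i) ∧ ∑ i, petalWeight (ℓ i) = 1 := by
  refine and_congr_right fun hℓ => ⟨fun h => ?_, fun h => ?_⟩
  · simpa [h] using (roseEntropy_spec hℓ).2
  · exact roseEntropy_eq hℓ one_pos (by simpa using h)

theorem isOpen_positive : IsOpen {ℓ : ι → ℝ | ∀ i, 0 < ℓ i} := by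
  simp only [ofPred_forall]
  exact isOpen_iInter_of_finite fun i => isOpen_lt continuous_const (continuous_apply i)

/-- Implicit function theorem for `∑ petalWeight (s * ℓ i) = 1`, whose derivative in `s` is
negative. Near `ℓ` the implicit function is positive and so equals the entropy by uniqueness of the
root. -/
theorem contDiffAt_roseEntropy [Nontrivial ι] {ℓ : ι → ℝ} (hℓ : ∀ i, 0 < ℓ i) :
    ContDiffAt ℝ ∞ (roseEntropy : (ι → ℝ) → ℝ) ℓ := by
  obtain ⟨hpos, hsum⟩ := roseEntropy_spec hℓ
  set f : (ι → ℝ) × ℝ → ℝ := fun p => ∑ i, petalWeight (p.2 * p.1 i) with hf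
  set u : (ι → ℝ) × ℝ := (ℓ, roseEntropy ℓ)
  have hcd : ContDiffAt ℝ ∞ f u := by
    refine ContDiffAt.sum fun i _ => contDiff_petalWeight.contDiffAt.comp u ?_
    exact contDiffAt_snd.mul ((contDiff_apply ℝ ℝ i).contDiffAt.comp u contDiffAt_fst)
  have hinv : (fderiv ℝ f u ∘L .inr ℝ (ι → ℝ) ℝ).IsInvertible := by
    have hd : HasDerivAt (fun s : ℝ => f (ℓ, s))
        (∑ i, petalWeightDeriv (roseEntropy ℓ * ℓ i) * ℓ i) (roseEntropy ℓ) := by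
      refine HasDerivAt.fun_sum fun i _ => ?_
      exact (HasDerivAt.comp (h₂ := petalWeight) (h := fun s => s * ℓ i)
        (roseEntropy ℓ) (hasDerivAt_petalWeight _)
        ((hasDerivAt_id' _).mul_const (ℓ i))).congr_deriv (by rw [one_mul])
    have hd' : HasFDerivAt (fun s : ℝ => f (ℓ, s)) (fderiv ℝ f u ∘L .inr ℝ (ι → ℝ) ℝ)
        (roseEntropy ℓ) :=
      (hcd.differentiableAt (by simp)).hasFDerivAt.comp (roseEntropy ℓ)
        (hasFDerivAt_prodMk_right ℓ (roseEntropy ℓ))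
    rw [hd'.unique hd.hasFDerivAt]
    have hne : ∑ i, petalWeightDeriv (roseEntropy ℓ * ℓ i) * ℓ i ≠ 0 :=
      (Finset.sum_neg (fun i _ => mul_neg_of_neg_of_pos (petalWeightDeriv_neg _) (hℓ i))
        Finset.univ_nonempty).ne
    refine ⟨ContinuousLinearEquiv.unitsEquivAut ℝ (Units.mk0 _ hne), ?_⟩
    ext
    simp
  have hn : (∞ : WithTop ℕ∞) ≠ 0 := by simp
  refine (hcd.contDiffAt_implicitFunction hn hinv).congr_of_eventuallyEq ?_
  have hlim := (hcd.contDiffAt_implicitFunction hn hinv).continuousAt.tendsto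
  rw [hcd.implicitFunction_apply_self hn hinv] at hlim
  filter_upwards [hcd.eventually_apply_implicitFunction hn hinv, isOpen_positive.mem_nhds hℓ,
    hlim.eventually (lt_mem_nhds hpos)] with ℓ' h1 h2 h3
  exact roseEntropy_eq h2 h3 (h1.trans hsum)

/-- The Hessian of the entropy on tangent vectors of the moduli space. -/
theorem entropyForm_eq [Nontrivial ι] {ℓ v : ι → ℝ} (hℓ : IsUnitEntropy ℓ)
    (hv : ∑ i, petalWeightDeriv (ℓ i) * v i = 0) :
    entropyForm ℓ v v
      = (∑ i, petalWeightDeriv₂ (ℓ i) * v i ^ 2) / ∑ i, -petalWeightDeriv (ℓ i) * ℓ i := by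
  obtain ⟨hpos, hone⟩ := hℓ
  -- A straight line suffices, although it leaves the moduli space: its second derivative of entropy
  -- is exactly the Hessian form.
  set γ : ℝ → ι → ℝ := fun s => ℓ + s • v with hγ
  have hγd : ∀ s, HasDerivAt γ v s := fun s => by
    simpa only [one_smul] using ((hasDerivAt_id' s).smul_const v).const_add ℓ
  have hγi : ∀ s i, HasDerivAt (fun s => γ s i) (v i) s := fun s i =>
    (hasDerivAt_pi.1 (hγd s)) i
  have hγ0 : γ 0 = ℓ := by simp [hγ]
  have hev : ∀ᶠ s in 𝓝 (0 : ℝ), ∀ i, 0 < γ s i :=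
    (hγd 0).continuousAt.eventually (isOpen_positive.mem_nhds (by rw [hγ0]; exact hpos))
  set A : ℝ → ℝ := fun s => fderiv ℝ (roseEntropy : (ι → ℝ) → ℝ) (γ s) v with hA
  have hφ : ∀ᶠ s in 𝓝 (0 : ℝ), HasDerivAt (fun s => roseEntropy (γ s)) (A s) s := by
    filter_upwards [hev] with s hs
    exact ((contDiffAt_roseEntropy hs).differentiableAt (by simp)).hasFDerivAt.comp_hasDerivAt s
      (hγd s)
  have hA' : HasDerivAt A (entropyForm ℓ v v) 0 := by
    have h1 : DifferentiableAt ℝ (fderiv ℝ (roseEntropy : (ι → ℝ) → ℝ)) (γ 0) := by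
      rw [hγ0]
      exact ((contDiffAt_roseEntropy hpos).fderiv_right (m := 1)
        (by norm_cast)).differentiableAt (by simp)
    have h2 := (h1.hasFDerivAt.comp_hasDerivAt (0 : ℝ) (hγd 0)).clm_apply
      (hasDerivAt_const (0 : ℝ) v)
    rw [hγ0] at h2
    simpa [entropyForm] using h2
  have hzero : ∀ᶠ s in 𝓝 (0 : ℝ), ∑ i, petalWeightDeriv (roseEntropy (γ s) * γ s i)
      * (A s * γ s i + roseEntropy (γ s) * v i) = 0 := by
    filter_upwards [hφ, hev.eventually_nhds] with s h1 h2
    have h3 : HasDerivAt (fun s => ∑ i, petalWeight (roseEntropy (γ s) * γ s i))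
        (∑ i, petalWeightDeriv (roseEntropy (γ s) * γ s i)
          * (A s * γ s i + roseEntropy (γ s) * v i)) s :=
      HasDerivAt.fun_sum fun i _ =>
        HasDerivAt.comp (h₂ := petalWeight) (h := fun s => roseEntropy (γ s) * γ s i) s
          (hasDerivAt_petalWeight _) (h1.fun_mul (hγi s i))
    refine h3.unique ((hasDerivAt_const s 1).congr_of_eventuallyEq ?_)
    filter_upwards [h2] with s' h4
    exact (roseEntropy_spec h4).2
  have hD : 0 < ∑ i, -petalWeightDeriv (ℓ i) * ℓ i :=
    Finset.sum_pos (fun i _ => mul_pos (neg_pos.2 (petalWeightDeriv_neg _)) (hpos i))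
      Finset.univ_nonempty
  have hφ0 := hφ.self_of_nhds
  -- By tangency the entropy is stationary to first order, which removes the cross terms from the
  -- second derivative.
  have hA0 : A 0 = 0 := by
    have h := hzero.self_of_nhds
    simp only [hγ0, hone, one_mul, mul_add, Finset.sum_add_distrib, hv, add_zero] at h
    have h' : A 0 * ∑ i, -petalWeightDeriv (ℓ i) * ℓ i = 0 := by
      rw [Finset.mul_sum, ← neg_eq_zero, ← Finset.sum_neg_distrib]
      refine Eq.trans ?_ h
      exact Finset.sum_congr rfl fun i _ => by ring
    exact (mul_eq_zero.1 h').resolve_right hD.ne'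
  have h3 : HasDerivAt (fun s => ∑ i, petalWeightDeriv (roseEntropy (γ s) * γ s i)
      * (A s * γ s i + roseEntropy (γ s) * v i))
      (∑ i, (petalWeightDeriv₂ (ℓ i) * v i ^ 2
        + petalWeightDeriv (ℓ i) * (entropyForm ℓ v v * ℓ i))) 0 := by
    refine HasDerivAt.fun_sum fun i _ => ?_
    have h := (HasDerivAt.comp (h₂ := petalWeightDeriv)
      (h := fun s => roseEntropy (γ s) * γ s i) 0 (hasDerivAt_petalWeightDeriv _)
      (hφ0.fun_mul (hγi 0 i))).fun_mul ((hA'.fun_mul (hγi 0 i)).fun_add (hφ0.mul_const (v i)))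
    refine h.congr_deriv ?_
    simp only [hA0, hγ0, hone, Function.comp, one_mul]
    ring
  have h4 := h3.unique ((hasDerivAt_const 0 0).congr_of_eventuallyEq hzero)
  rw [eq_div_iff hD.ne', Finset.mul_sum, ← sub_eq_zero, ← neg_eq_zero, ← h4,
    ← Finset.sum_sub_distrib, ← Finset.sum_neg_distrib]
  exact Finset.sum_congr rfl fun i _ => by ring

end Entropy

/-! ### Piecewise smooth paths -/

theorem eventually_notMem_Ioo_right (P : Finset ℝ) (t : ℝ) :
    ∀ᶠ b in 𝓝[>] t, ∀ p ∈ P, p ∉ Ioo t b := by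
  rw [Filter.eventually_all_finset]
  intro p _
  rcases le_or_gt p t with h | h
  · exact Eventually.of_forall fun b hb => absurd hb.1 (not_lt.2 h)
  · filter_upwards [Ioo_mem_nhdsGT h] with b hb hpb using absurd hpb.2 (not_lt.2 hb.2.le)

theorem eventually_notMem_Ioo_left (P : Finset ℝ) (t : ℝ) :
    ∀ᶠ a in 𝓝[<] t, ∀ p ∈ P, p ∉ Ioo a t := by
  rw [Filter.eventually_all_finset]
  intro p _
  rcases le_or_gt t p with h | h
  · exact Eventually.of_forall fun b hb => absurd hb.2 (not_lt.2 h)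
  · filter_upwards [Ioo_mem_nhdsLT h] with b hb hpb using absurd hpb.1 (not_lt.2 hb.1.le)

section Paths

variable {ι : Type*} [Fintype ι] {γ : ℝ → ι → ℝ}

theorem IsPiecewiseSmooth.continuousOn (h : IsPiecewiseSmooth γ) : ContinuousOn γ (Icc 0 1) := by
  obtain ⟨P, hP⟩ := h
  intro t ht
  have hr : ContinuousWithinAt γ (Icc t 1) t := by
    rcases ht.2.eq_or_lt with rfl | h1
    · simp
    · obtain ⟨b, hb, hb1⟩ := ((eventually_notMem_Ioo_right P t).and (Ioc_mem_nhdsGT h1)).exists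
      refine ((hP t b ht.1 hb1.1 hb1.2 hb).continuousOn t ⟨le_rfl, hb1.1.le⟩).mono_of_mem_nhdsWithin
        (mem_nhdsWithin.2 ⟨Iio b, isOpen_Iio, hb1.1, fun x hx => ⟨hx.2.1, le_of_lt hx.1⟩⟩)
  have hl : ContinuousWithinAt γ (Icc 0 t) t := by
    rcases ht.1.eq_or_lt with rfl | h1
    · simp
    · obtain ⟨b, hb, hb1⟩ := ((eventually_notMem_Ioo_left P t).and (Ico_mem_nhdsLT h1)).exists
      refine ((hP b t hb1.1 hb1.2 ht.2 hb).continuousOn t ⟨hb1.2.le, le_rfl⟩).mono_of_mem_nhdsWithin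
        (mem_nhdsWithin.2 ⟨Ioi b, isOpen_Ioi, hb1.2, fun x hx => ⟨le_of_lt hx.1, hx.2.2⟩⟩)
  have := hl.union hr
  rwa [Icc_union_Icc_eq_Icc ht.1 ht.2] at this

theorem IsPiecewiseSmooth.exists_differentiableAt (h : IsPiecewiseSmooth γ) :
    ∃ P : Finset ℝ, ∀ t ∈ Ioo (0 : ℝ) 1, t ∉ P → DifferentiableAt ℝ γ t := by
  obtain ⟨P, hP⟩ := h
  refine ⟨P, fun t ht htP => ?_⟩
  obtain ⟨b, hb, hb1⟩ := ((eventually_notMem_Ioo_right P t).and (Ioc_mem_nhdsGT ht.2)).exists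
  obtain ⟨a, ha, ha1⟩ := ((eventually_notMem_Ioo_left P t).and (Ico_mem_nhdsLT ht.1)).exists
  have := hP a b ha1.1 (ha1.2.trans hb1.1) hb1.2 fun p hp hpab => by
    rcases lt_trichotomy p t with h | h | h
    · exact ha p hp ⟨hpab.1, h⟩
    · exact htP (h ▸ hp)
    · exact hb p hp ⟨h, hpab.2⟩
  exact (this.contDiffAt (Icc_mem_nhds ha1.2 hb1.1)).differentiableAt (by simp)

end Paths

/-- There is nothing to prove if the right side is infinite; otherwise the derivative is integrable
and the fundamental theorem of calculus holds off a countable set. -/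
theorem ofReal_abs_sub_le_lintegral_deriv {f : ℝ → ℝ} (hf : ContinuousOn f (Icc 0 1))
    {P : Set ℝ} (hP : P.Countable) (hd : ∀ t ∈ Ioo (0 : ℝ) 1 \ P, DifferentiableAt ℝ f t) :
    ENNReal.ofReal |f 1 - f 0| ≤ ∫⁻ t in Icc (0 : ℝ) 1, ENNReal.ofReal |deriv f t| := by
  by_cases htop : ∫⁻ t in Icc (0 : ℝ) 1, ENNReal.ofReal |deriv f t| = ⊤
  · rw [htop]
    exact le_top
  have hint : Integrable (deriv f) (volume.restrict (Icc 0 1)) := by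
    refine ⟨(measurable_deriv f).aestronglyMeasurable, ?_⟩
    rw [hasFiniteIntegral_iff_norm]
    exact lt_top_iff_ne_top.2 htop
  have hint' : IntervalIntegrable (deriv f) volume 0 1 := by
    rw [intervalIntegrable_iff_integrableOn_Icc_of_le zero_le_one]
    exact hint
  have h := integral_eq_of_hasDerivAt_off_countable_of_le f (deriv f) zero_le_one hP hf
    (fun t ht => (hd t ht).hasDerivAt) hint'
  rw [← h, intervalIntegral.integral_of_le zero_le_one, ← integral_Icc_eq_integral_Ioc]
  calc ENNReal.ofReal |∫ t in Icc (0 : ℝ) 1, deriv f t|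
      ≤ ENNReal.ofReal (∫ t in Icc (0 : ℝ) 1, |deriv f t|) :=
        ENNReal.ofReal_le_ofReal (abs_integral_le_integral_abs)
    _ = _ := ofReal_integral_eq_lintegral_ofReal hint.abs
        (Eventually.of_forall fun t => abs_nonneg _)

/-! ### Estimates for the Hessian -/

theorem log_two_sub_petalWeight_div (x : ℝ) :
    Real.log ((2 - petalWeight x) / petalWeight x) = x := by
  have : (2 - petalWeight x) / petalWeight x = Real.exp x := by
    unfold petalWeight
    field_simp
    ring
  rw [this, Real.log_exp]

theorem petalWeight_log {u : ℝ} (h0 : 0 < u) (h1 : u < 2) :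
    petalWeight (Real.log ((2 - u) / u)) = u := by
  have : 0 < 2 - u := by linarith
  rw [petalWeight, Real.exp_log (by positivity)]
  field_simp
  ring

section Estimates

variable {ι : Type*} [Fintype ι] {ℓ : ι → ℝ}

/-- The normalizing denominator of the entropy metric. -/
def entropySlope (ℓ : ι → ℝ) : ℝ := ∑ i, -petalWeightDeriv (ℓ i) * ℓ i

theorem entropySlope_pos [Nonempty ι] (hℓ : ∀ i, 0 < ℓ i) : 0 < entropySlope ℓ :=
  Finset.sum_pos (fun i _ => mul_pos (neg_pos.2 (petalWeightDeriv_neg _)) (hℓ i))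
    Finset.univ_nonempty

/-- Let `ε = 1 - u i`. For `j = i` the length is at most `2 * ε / u i`. For `j ≠ i` one has `u j ≤
ε` and `ℓ j ≤ log (2 / u j)`, and `u * log (1 / u)` is controlled by `log x ≤ x - 1` at `x = ε / u
j`. -/
theorem neg_petalWeightDeriv_mul_le (hpos : ∀ i, 0 < ℓ i) (hsum : ∑ i, petalWeight (ℓ i) = 1)
    (i j : ι) : -petalWeightDeriv (ℓ j) * ℓ j
      ≤ 2 * (1 - petalWeight (ℓ i)) * (1 - Real.log (1 - petalWeight (ℓ i))) := by
  classical
  set ε := 1 - petalWeight (ℓ i) with hε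
  have hε0 : 0 < ε := sub_pos.2 (petalWeight_lt_one (hpos i))
  have hε1 : ε < 1 := by linarith [petalWeight_pos (ℓ i)]
  have hlog : Real.log ε < 0 := Real.log_neg hε0 hε1
  set u := petalWeight (ℓ j) with hu
  have hu0 : 0 < u := petalWeight_pos _
  have hu1 : u < 1 := petalWeight_lt_one (hpos j)
  have hle : -petalWeightDeriv (ℓ j) * ℓ j ≤ u * ℓ j := by
    have := hpos j
    have h : -petalWeightDeriv (ℓ j) ≤ u := by
      unfold petalWeightDeriv
      nlinarith
    gcongr
  refine hle.trans ?_
  have hlen : ℓ j = Real.log ((2 - u) / u) := (log_two_sub_petalWeight_div _).symm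
  have h2u : 0 < 2 - u := by linarith
  by_cases hij : j = i
  · subst hij
    have h1 : ℓ j ≤ (2 - u) / u - 1 := by
      rw [hlen]
      exact Real.log_le_sub_one_of_pos (by positivity)
    have h2 : u * ((2 - u) / u - 1) = 2 * ε := by
      rw [hε]
      field_simp
      ring
    nlinarith [mul_le_mul_of_nonneg_left h1 hu0.le]
  · have huε : u ≤ ε := by
      have : petalWeight (ℓ i) + petalWeight (ℓ j) ≤ ∑ k, petalWeight (ℓ k) := by
        rw [← Finset.sum_pair (Ne.symm hij) (f := fun k => petalWeight (ℓ k))]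
        exact Finset.sum_le_sum_of_subset_of_nonneg (Finset.subset_univ _)
          fun k _ _ => (petalWeight_pos _).le
      linarith
    have h1 : ℓ j ≤ Real.log (2 / u) := by
      rw [hlen]
      gcongr
      linarith
    rw [Real.log_div two_ne_zero hu0.ne'] at h1
    have h2 : Real.log ε - Real.log u ≤ ε / u - 1 := by
      rw [← Real.log_div hε0.ne' hu0.ne']
      exact Real.log_le_sub_one_of_pos (by positivity)
    have h3 : u * (ε / u - 1) = ε - u := by field_simp
    have h4 : Real.log 2 ≤ 1 := by linarith [Real.log_two_lt_d9]
    have h5 : 0 ≤ Real.log 2 - Real.log ε := by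
      linarith [Real.log_nonneg one_le_two]
    nlinarith [mul_le_mul_of_nonneg_left h1 hu0.le, mul_le_mul_of_nonneg_left h2 hu0.le,
      mul_le_mul_of_nonneg_right huε h5, mul_nonneg hε0.le (neg_nonneg.2 hlog.le)]

theorem entropySlope_le (hpos : ∀ i, 0 < ℓ i) (hsum : ∑ i, petalWeight (ℓ i) = 1) (i : ι) :
    entropySlope ℓ ≤ 2 * Fintype.card ι
      * ((1 - petalWeight (ℓ i)) * (1 - Real.log (1 - petalWeight (ℓ i)))) := by
  refine (Finset.sum_le_card_nsmul _ _ _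
    fun j _ => neg_petalWeightDeriv_mul_le hpos hsum i j).trans (le_of_eq ?_)
  rw [nsmul_eq_mul, Finset.card_univ]
  ring

/-- Away from the vertices every length is at least `log (1 + δ)`, and the weights averaging these
lengths sum to one. -/
theorem le_entropySlope (hsum : ∑ i, petalWeight (ℓ i) = 1)
    {δ : ℝ} (hδ : 0 < δ) (h : ∀ i, petalWeight (ℓ i) ≤ 1 - δ) :
    Real.log (1 + δ) / 2 ≤ entropySlope ℓ := by
  calc Real.log (1 + δ) / 2 = ∑ i, petalWeight (ℓ i) * (Real.log (1 + δ) / 2) := by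
        rw [← Finset.sum_mul, hsum, one_mul]
    _ ≤ _ := by
        refine Finset.sum_le_sum fun i _ => ?_
        have hu := petalWeight_pos (ℓ i)
        have hi := h i
        have h1 : Real.log (1 + δ) ≤ ℓ i := by
          rw [← log_two_sub_petalWeight_div (ℓ i)]
          gcongr
          rw [le_div_iff₀ hu]
          nlinarith
        have h0 : 0 ≤ Real.log (1 + δ) := Real.log_nonneg (by linarith)
        have h2 : petalWeight (ℓ i) / 2 ≤ -petalWeightDeriv (ℓ i) := by
          unfold petalWeightDeriv
          nlinarith
        calc petalWeight (ℓ i) * (Real.log (1 + δ) / 2)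
            = petalWeight (ℓ i) / 2 * Real.log (1 + δ) := by ring
          _ ≤ _ := mul_le_mul h2 h1 h0 (le_trans (by positivity) h2)

theorem one_sub_mul_sq_le {x : ℝ} (hx : 0 < x) (v : ℝ) :
    (1 - petalWeight x) * (petalWeightDeriv x * v) ^ 2
      ≤ petalWeight x * (petalWeightDeriv₂ x * v ^ 2) := by
  have h0 := petalWeight_pos x
  have h1 := petalWeight_lt_one hx
  set u := petalWeight x
  have h : 0 ≤ u ^ 2 * (1 - u) * (2 - u) * u * v ^ 2 / 4 := by
    have h2 : 0 < 1 - u := by linarith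
    have h3 : 0 < 2 - u := by linarith
    positivity
  have : petalWeight x * (petalWeightDeriv₂ x * v ^ 2)
      - (1 - petalWeight x) * (petalWeightDeriv x * v) ^ 2
        = u ^ 2 * (1 - u) * (2 - u) * u * v ^ 2 / 4 := by
    unfold petalWeightDeriv petalWeightDeriv₂
    ring
  linarith

theorem petalWeightDeriv₂_mul_sq_le {x : ℝ} (hx : 0 < x) (v : ℝ) :
    petalWeightDeriv₂ x * v ^ 2 ≤ (petalWeightDeriv x * v) ^ 2 / petalWeight x := by
  have h0 := petalWeight_pos x
  have h1 := petalWeight_lt_one hx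
  rw [le_div_iff₀ h0]
  set u := petalWeight x
  have h : 0 ≤ u ^ 3 * (2 - u) * v ^ 2 / 4 := by
    have h3 : 0 < 2 - u := by linarith
    positivity
  have : (petalWeightDeriv x * v) ^ 2 - petalWeightDeriv₂ x * v ^ 2 * petalWeight x
      = u ^ 3 * (2 - u) * v ^ 2 / 4 := by
    unfold petalWeightDeriv petalWeightDeriv₂
    ring
  linarith

/-- For `u i ≤ 1 / 2` the `i`-th term of the sum is enough. Otherwise tangency gives `w i = -∑ w j`
over the other petals, and Cauchy–Schwarz with weights `u j`, of total `1 - u i`, gains the factor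
`1 - u i`. -/
theorem sq_petalWeightDeriv_mul_le (hpos : ∀ i, 0 < ℓ i) (hsum : ∑ i, petalWeight (ℓ i) = 1)
    {v : ι → ℝ} (hv : ∑ i, petalWeightDeriv (ℓ i) * v i = 0) (i : ι) :
    (petalWeightDeriv (ℓ i) * v i) ^ 2
      ≤ 4 * (1 - petalWeight (ℓ i)) * ∑ j, petalWeightDeriv₂ (ℓ j) * v j ^ 2 := by
  classical
  set T : ι → ℝ := fun j => petalWeightDeriv₂ (ℓ j) * v j ^ 2 with hT
  set w : ι → ℝ := fun j => petalWeightDeriv (ℓ j) * v j with hw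
  set u : ι → ℝ := fun j => petalWeight (ℓ j) with hu
  have hT0 : ∀ j, 0 ≤ T j := fun j => mul_nonneg (petalWeightDeriv₂_nonneg (hpos j)) (sq_nonneg _)
  have hu0 : ∀ j, 0 < u j := fun j => petalWeight_pos _
  have hu1 : ∀ j, u j < 1 := fun j => petalWeight_lt_one (hpos j)
  have hwT : ∀ j, (1 - u j) * w j ^ 2 ≤ u j * T j := fun j => one_sub_mul_sq_le (hpos j) _
  have hsumT : 0 ≤ ∑ j, T j := Finset.sum_nonneg fun j _ => hT0 j
  change w i ^ 2 ≤ 4 * (1 - u i) * ∑ j, T j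
  have h0 := hu0 i
  have h1 := hu1 i
  rcases le_or_gt (1 / 2) (1 - u i) with h | h
  · have h3 : T i ≤ ∑ j, T j := Finset.single_le_sum (fun j _ => hT0 j) (Finset.mem_univ i)
    have h4 := hwT i
    nlinarith [mul_le_mul_of_nonneg_right h (sq_nonneg (w i)), mul_le_mul_of_nonneg_right h1.le
      (hT0 i), mul_le_mul_of_nonneg_right h hsumT]
  · have hw' : w i = -∑ j ∈ Finset.univ.erase i, w j := by
      rw [Finset.sum_erase_eq_sub (Finset.mem_univ i), hv]
      ring
    have hu' : ∑ j ∈ Finset.univ.erase i, u j = 1 - u i := by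
      rw [Finset.sum_erase_eq_sub (Finset.mem_univ i), hsum]
    have h3 := Finset.sq_sum_div_le_sum_sq_div (Finset.univ.erase i) w (fun j _ => hu0 j)
    rw [hu', div_le_iff₀ (by linarith)] at h3
    have h4 : ∑ j ∈ Finset.univ.erase i, w j ^ 2 / u j ≤ 2 * ∑ j, T j := by
      calc ∑ j ∈ Finset.univ.erase i, w j ^ 2 / u j
          ≤ ∑ j ∈ Finset.univ.erase i, 2 * T j := by
            refine Finset.sum_le_sum fun j hj => ?_
            rw [div_le_iff₀ (hu0 j)]
            have h5 : u j ≤ 1 - u i := by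
              rw [← hu']
              exact Finset.single_le_sum (fun k _ => (hu0 k).le) hj
            nlinarith [hwT j, mul_le_mul_of_nonneg_right (show 1 / 2 ≤ 1 - u j by linarith)
              (sq_nonneg (w j))]
        _ ≤ ∑ j, 2 * T j := Finset.sum_le_sum_of_subset_of_nonneg (Finset.subset_univ _)
            fun j _ _ => mul_nonneg zero_le_two (hT0 j)
        _ = _ := by rw [Finset.mul_sum]
    rw [hw', neg_sq]
    nlinarith

/-- A proper function of the length of a petal that is Lipschitz for the entropy metric. -/
def petalHeight (x : ℝ) : ℝ := √(1 - Real.log (1 - petalWeight x))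

theorem one_le_one_sub_log {x : ℝ} (hx : 0 < x) : 1 ≤ 1 - Real.log (1 - petalWeight x) := by
  have := Real.log_nonpos (sub_nonneg.2 (petalWeight_lt_one hx).le)
    (by linarith [petalWeight_pos x])
  linarith

theorem hasDerivAt_petalHeight {x : ℝ} (hx : 0 < x) :
    HasDerivAt petalHeight
      (petalWeightDeriv x / (1 - petalWeight x) / (2 * petalHeight x)) x := by
  have h1 := sub_pos.2 (petalWeight_lt_one hx)
  have h2 := one_le_one_sub_log hx
  have h := ((((hasDerivAt_petalWeight x).const_sub 1).log h1.ne').const_sub 1).sqrt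
    (by linarith)
  refine h.congr_deriv ?_
  rw [petalHeight]
  ring

theorem abs_deriv_petalHeight_le [Nontrivial ι] {v : ι → ℝ} (hℓ : IsUnitEntropy ℓ)
    (hv : ∑ i, petalWeightDeriv (ℓ i) * v i = 0) (i : ι) :
    |petalWeightDeriv (ℓ i) / (1 - petalWeight (ℓ i)) / (2 * petalHeight (ℓ i)) * v i|
      ≤ √(2 * Fintype.card ι) * entropyNorm ℓ v := by
  obtain ⟨hpos, hsum⟩ := isUnitEntropy_iff.1 hℓ
  have hε := sub_pos.2 (petalWeight_lt_one (hpos i))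
  have hφ := one_le_one_sub_log (hpos i)
  have hD := entropySlope_pos hpos
  have h1 := entropySlope_le hpos hsum i
  have h2 := sq_petalWeightDeriv_mul_le hpos hsum hv i
  have hT : 0 ≤ ∑ j, petalWeightDeriv₂ (ℓ j) * v j ^ 2 :=
    Finset.sum_nonneg fun j _ => mul_nonneg (petalWeightDeriv₂_nonneg (hpos j)) (sq_nonneg _)
  rw [entropyNorm, entropyForm_eq hℓ hv, ← Real.sqrt_mul (by positivity)]
  apply Real.abs_le_sqrt
  change _ ≤ 2 * Fintype.card ι * (_ / entropySlope ℓ)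
  have hH : petalHeight (ℓ i) ^ 2 = 1 - Real.log (1 - petalWeight (ℓ i)) :=
    Real.sq_sqrt (by linarith)
  have hform : (petalWeightDeriv (ℓ i) / (1 - petalWeight (ℓ i)) / (2 * petalHeight (ℓ i))
      * v i) ^ 2 = (petalWeightDeriv (ℓ i) * v i) ^ 2
        / (4 * (1 - petalWeight (ℓ i)) ^ 2 * (1 - Real.log (1 - petalWeight (ℓ i)))) := by
    rw [← hH]
    have : petalHeight (ℓ i) ≠ 0 := by
      intro h
      rw [h] at hH
      linarith
    field_simp
    ring
  rw [hform]
  set ε := 1 - petalWeight (ℓ i)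
  set Λ := 1 - Real.log ε
  set T := ∑ j, petalWeightDeriv₂ (ℓ j) * v j ^ 2
  have hΛ : 0 < Λ := by linarith
  rw [← mul_div_assoc, div_le_div_iff₀ (by positivity) hD]
  calc _ ≤ (4 * ε * T) * (2 * Fintype.card ι * (ε * Λ)) :=
        mul_le_mul h2 h1 hD.le (by positivity)
    _ = _ := by ring

end Estimates

/-! ### Bounds for the entropy distance -/

theorem sqrt_sum_le_sum_sqrt {ι : Type*} {s : Finset ι} {f : ι → ℝ} (hf : ∀ i, 0 ≤ f i) :
    √(∑ i ∈ s, f i) ≤ ∑ i ∈ s, √(f i) := by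
  rw [Real.sqrt_le_left (Finset.sum_nonneg fun i _ => Real.sqrt_nonneg _)]
  calc ∑ i ∈ s, f i = ∑ i ∈ s, √(f i) ^ 2 :=
        Finset.sum_congr rfl fun i _ => (Real.sq_sqrt (hf i)).symm
    _ ≤ _ := Finset.sum_sq_le_sq_sum_of_nonneg fun i _ => Real.sqrt_nonneg _

section Distance

variable {ι : Type*} [Fintype ι] [Nontrivial ι]

theorem IsModuliPath.sum_petalWeightDeriv_mul_deriv {x y : RoseModuli ι} {γ : ℝ → ι → ℝ}
    (h : IsModuliPath x y γ) {t : ℝ} (ht : t ∈ Ioo (0 : ℝ) 1) (hd : DifferentiableAt ℝ γ t) :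
    ∑ i, petalWeightDeriv (γ t i) * deriv γ t i = 0 := by
  have h1 : HasDerivAt (fun s => ∑ i, petalWeight (γ s i))
      (∑ i, petalWeightDeriv (γ t i) * deriv γ t i) t :=
    HasDerivAt.fun_sum fun i _ => HasDerivAt.comp (h₂ := petalWeight) (h := fun s => γ s i) t
      (hasDerivAt_petalWeight _) (hasDerivAt_pi.1 hd.hasDerivAt i)
  refine h1.unique ((hasDerivAt_const t 1).congr_of_eventuallyEq ?_)
  filter_upwards [Ioo_mem_nhds ht.1 ht.2] with s hs
  exact (isUnitEntropy_iff.1 (h.mem s ⟨hs.1.le, hs.2.le⟩)).2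

/-- The height blows up as the weight tends to one, so this puts the vertices of the simplex at
infinite distance. -/
theorem lipschitzWith_petalHeight (i : ι) :
    LipschitzWith (NNReal.sqrt (2 * Fintype.card ι))
      fun x : RoseModuli ι => petalHeight (x.len i) := by
  intro x y
  set K : ℝ≥0∞ := (NNReal.sqrt (2 * Fintype.card ι) : ℝ≥0∞) with hK
  have hKr : K = ENNReal.ofReal √(2 * Fintype.card ι) := by
    rw [hK, ← ENNReal.ofReal_coe_nnreal]
    simp
  have hK0 : K ≠ 0 := by
    rw [hK, Ne, ENNReal.coe_eq_zero, NNReal.sqrt_eq_zero]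
    simp
  have hKtop : K ≠ ⊤ := ENNReal.coe_ne_top
  rw [← ENNReal.div_le_iff' hK0 hKtop]
  refine le_iInf₂ fun γ h => ?_
  rw [ENNReal.div_le_iff' hK0 hKtop]
  obtain ⟨P, hP⟩ := h.smooth.exists_differentiableAt
  have hγpos : ∀ t ∈ Icc (0 : ℝ) 1, 0 < γ t i := fun t ht => (h.mem t ht).1 i
  have hderiv : ∀ t ∈ Ioo (0 : ℝ) 1 \ P, HasDerivAt (fun s => petalHeight (γ s i))
      (petalWeightDeriv (γ t i) / (1 - petalWeight (γ t i)) / (2 * petalHeight (γ t i))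
        * deriv γ t i) t := fun t ht =>
    HasDerivAt.comp (h₂ := petalHeight) (h := fun s => γ s i) t
      (hasDerivAt_petalHeight (hγpos t (Ioo_subset_Icc_self ht.1)))
      (hasDerivAt_pi.1 (hP t ht.1 ht.2).hasDerivAt i)
  have hcont : ContinuousOn (fun s => petalHeight (γ s i)) (Icc 0 1) := by
    intro t ht
    exact ContinuousAt.comp_continuousWithinAt (f := fun s => γ s i)
      (hasDerivAt_petalHeight (hγpos t ht)).continuousAt
      ((continuous_apply i).continuousAt.comp_continuousWithinAt (h.smooth.continuousOn t ht))
  have := ofReal_abs_sub_le_lintegral_deriv hcont P.countable_toSet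
    fun t ht => (hderiv t ht).differentiableAt
  rw [h.source, h.target] at this
  rw [edist_comm, edist_dist, Real.dist_eq]
  refine this.trans ?_
  rw [entropyLengthOn, ← lintegral_const_mul' _ _ hKtop, ← restrict_Ioo_eq_restrict_Icc]
  refine lintegral_mono_ae ?_
  have hPae : ∀ᵐ t ∂(volume.restrict (Ioo (0 : ℝ) 1)), t ∉ (P : Set ℝ) :=
    ae_restrict_of_ae (P.countable_toSet.ae_notMem volume)
  filter_upwards [hPae, ae_restrict_mem measurableSet_Ioo] with t htP ht
  rw [hKr, ← ENNReal.ofReal_mul (Real.sqrt_nonneg _), (hderiv t ⟨ht, htP⟩).deriv]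
  exact ENNReal.ofReal_le_ofReal (abs_deriv_petalHeight_le (h.mem t (Ioo_subset_Icc_self ht))
    (h.sum_petalWeightDeriv_mul_deriv ht (hP t ht htP)) i)

theorem integrableOn_inv_sqrt_add :
    IntegrableOn (fun t : ℝ => 1 / √t + 1 / √(1 - t)) (Icc 0 1) := by
  have h1 : IntervalIntegrable (fun t : ℝ => 1 / √t) volume 0 1 := by
    refine (intervalIntegral.intervalIntegrable_rpow' (r := -(1 / 2)) (by norm_num)).congr ?_
    intro t ht
    rw [uIoc_of_le zero_le_one] at ht
    simp only [Real.rpow_neg ht.1.le, Real.sqrt_eq_rpow, one_div]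
  have h2 : IntervalIntegrable (fun t : ℝ => 1 / √(1 - t)) volume 0 1 := by
    simpa using (h1.comp_sub_left 1).symm
  exact (intervalIntegrable_iff_integrableOn_Icc_of_le zero_le_one).1 (h1.add h2)

/-- The larger of `a` and `b` is at least `|b - a|`, so the convex combination is at least `t * |b -
a|` or `(1 - t) * |b - a|`. The bound is uniform as `a` or `b` tends to zero. -/
theorem abs_div_sqrt_le {a b t : ℝ} (ha : 0 < a) (hb : 0 < b) (ht : t ∈ Ioo (0 : ℝ) 1) :
    |b - a| / √((1 - t) * a + t * b) ≤ √|b - a| * (1 / √t + 1 / √(1 - t)) := by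
  obtain ⟨h0, h1⟩ := ht
  have h1' : 0 < 1 - t := by linarith
  rcases eq_or_ne a b with rfl | hab
  · simp
  have hd : 0 < |b - a| := abs_pos.2 (sub_ne_zero.2 hab.symm)
  have aux : ∀ s, 0 < s → s * |b - a| ≤ (1 - t) * a + t * b →
      |b - a| / √((1 - t) * a + t * b) ≤ √|b - a| * (1 / √s) := by
    intro s hs h
    calc |b - a| / √((1 - t) * a + t * b) ≤ |b - a| / √(s * |b - a|) := by gcongr
      _ = √|b - a| * (1 / √s) := by
        rw [Real.sqrt_mul hs.le]
        field_simp
        rw [Real.sq_sqrt hd.le]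
  rcases le_total a b with h | h
  · refine (aux t h0 ?_).trans ?_
    · rw [abs_of_nonneg (by linarith)]
      nlinarith
    · gcongr
      have : 0 ≤ 1 / √(1 - t) := by positivity
      linarith
  · refine (aux (1 - t) h1' ?_).trans ?_
    · rw [abs_of_nonpos (by linarith)]
      nlinarith
    · gcongr
      have : 0 ≤ 1 / √t := by positivity
      linarith

/-- The competitor path is the straight segment in weight coordinates, which keeps the distance `δ`
from the vertices. This gives a Hölder bound of exponent `1 / 2` that persists up to the open faces.
-/
theorem exists_edist_le {δ : ℝ} (hδ : 0 < δ) :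
    ∃ C : ℝ≥0∞, C ≠ ⊤ ∧ ∀ x y : RoseModuli ι, (∀ i, petalWeight (x.len i) ≤ 1 - δ) →
      (∀ i, petalWeight (y.len i) ≤ 1 - δ) →
      edist x y ≤ C * ENNReal.ofReal
        (∑ i, √|petalWeight (y.len i) - petalWeight (x.len i)|) := by
  set c := Real.log (1 + δ) / 2 with hc
  have hcpos : 0 < c := half_pos (Real.log_pos (by linarith))
  set κ := ∫⁻ t in Icc (0 : ℝ) 1, ENNReal.ofReal (1 / √t + 1 / √(1 - t)) with hκ
  refine ⟨ENNReal.ofReal (1 / √c) * κ,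
    ENNReal.mul_ne_top ENNReal.ofReal_ne_top integrableOn_inv_sqrt_add.lintegral_lt_top.ne,
    fun x y hx hy => ?_⟩
  obtain ⟨hxpos, hxsum⟩ := isUnitEntropy_iff.1 x.isUnitEntropy
  obtain ⟨hypos, hysum⟩ := isUnitEntropy_iff.1 y.isUnitEntropy
  set a : ι → ℝ := fun i => petalWeight (x.len i) with ha
  set b : ι → ℝ := fun i => petalWeight (y.len i) with hb
  have ha0 : ∀ i, 0 < a i := fun i => petalWeight_pos _
  have hb0 : ∀ i, 0 < b i := fun i => petalWeight_pos _
  set w : ℝ → ι → ℝ := fun t i => (1 - t) * a i + t * b i with hw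
  have hw0 : ∀ t ∈ Icc (0 : ℝ) 1, ∀ i, 0 < w t i := by
    intro t ht i
    have h1 := ha0 i
    have h2 := hb0 i
    rcases ht.1.eq_or_lt with h | h
    · simp only [hw, ← h]
      linarith
    · have := mul_nonneg (sub_nonneg.2 ht.2) h1.le
      have := mul_pos h h2
      simp only [hw]
      linarith
  have hwδ : ∀ t ∈ Icc (0 : ℝ) 1, ∀ i, w t i ≤ 1 - δ := by
    intro t ht i
    simp only [hw]
    nlinarith [mul_le_mul_of_nonneg_left (hx i) (sub_nonneg.2 ht.2),
      mul_le_mul_of_nonneg_left (hy i) ht.1]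
  have hwsum : ∀ t, ∑ i, w t i = 1 := by
    intro t
    simp only [hw, Finset.sum_add_distrib, ← Finset.mul_sum]
    rw [hxsum, hysum]
    ring
  -- The lengths are recovered from the weights through `exp (ℓ i) = (2 - u i) / u i`.
  set γ : ℝ → ι → ℝ := fun t i => Real.log ((2 - w t i) / w t i) with hγ
  have hγw : ∀ t ∈ Icc (0 : ℝ) 1, ∀ i, petalWeight (γ t i) = w t i := fun t ht i =>
    petalWeight_log (hw0 t ht i) (by linarith [hwδ t ht i])
  have hγpos : ∀ t ∈ Icc (0 : ℝ) 1, ∀ i, 0 < γ t i := by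
    intro t ht i
    have h1 := hw0 t ht i
    have h2 := hwδ t ht i
    refine Real.log_pos ?_
    rw [one_lt_div h1]
    linarith
  have hγunit : ∀ t ∈ Icc (0 : ℝ) 1, IsUnitEntropy (γ t) := fun t ht => by
    refine isUnitEntropy_iff.2 ⟨hγpos t ht, ?_⟩
    rw [← hwsum t]
    exact Finset.sum_congr rfl fun i _ => hγw t ht i
  have hγsmooth : ∀ t ∈ Icc (0 : ℝ) 1, ContDiffAt ℝ ∞ γ t := by
    intro t ht
    refine contDiffAt_pi.2 fun i => ?_
    have h1 := hw0 t ht i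
    have h2 := hwδ t ht i
    have hwd : ContDiff ℝ ∞ fun t => w t i := by
      simp only [hw]
      fun_prop
    refine ((contDiffAt_const.sub hwd.contDiffAt).div hwd.contDiffAt h1.ne').log ?_
    exact (div_pos (by linarith) h1).ne'
  have hpath : IsModuliPath x y γ := by
    refine ⟨⟨∅, fun p q hp _ hq _ t ht => ?_⟩, hγunit, ?_, ?_⟩
    · exact (hγsmooth t ⟨hp.trans ht.1, ht.2.trans hq⟩).contDiffWithinAt
    · ext i
      simp [hγ, hw, ha, log_two_sub_petalWeight_div]
    · ext i
      simp [hγ, hw, hb, log_two_sub_petalWeight_div]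
  refine (iInf₂_le γ hpath).trans ?_
  set S := ∑ i, √|b i - a i| with hS
  have hSnn : 0 ≤ S := Finset.sum_nonneg fun i _ => Real.sqrt_nonneg _
  rw [entropyLengthOn, mul_right_comm, ← ENNReal.ofReal_mul (by positivity), hκ,
    ← lintegral_const_mul' _ _ ENNReal.ofReal_ne_top, ← restrict_Ioo_eq_restrict_Icc]
  refine setLIntegral_mono' measurableSet_Ioo fun t ht => ?_
  rw [← ENNReal.ofReal_mul (by positivity)]
  refine ENNReal.ofReal_le_ofReal ?_
  have ht' := Ioo_subset_Icc_self ht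
  have hd : DifferentiableAt ℝ γ t := (hγsmooth t ht').differentiableAt (by simp)
  have htan := hpath.sum_petalWeightDeriv_mul_deriv ht hd
  have hvel : ∀ i, petalWeightDeriv (γ t i) * deriv γ t i = b i - a i := by
    intro i
    have h1 := HasDerivAt.comp (h₂ := petalWeight) (h := fun s => γ s i) t
      (hasDerivAt_petalWeight _) (hasDerivAt_pi.1 hd.hasDerivAt i)
    have h2 : HasDerivAt (fun s => w s i) (b i - a i) t := by
      have := (((hasDerivAt_id' t).const_sub 1).mul_const (a i)).fun_add
        ((hasDerivAt_id' t).mul_const (b i))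
      exact this.congr_deriv (by ring)
    refine h1.unique (h2.congr_of_eventuallyEq ?_)
    filter_upwards [Ioo_mem_nhds ht.1 ht.2] with s hs
    exact hγw s (Ioo_subset_Icc_self hs) i
  have hslope : c ≤ entropySlope (γ t) :=
    le_entropySlope (isUnitEntropy_iff.1 (hγunit t ht')).2 hδ fun i => by
      rw [hγw t ht' i]
      exact hwδ t ht' i
  rw [entropyNorm, entropyForm_eq (hγunit t ht') htan]
  calc √((∑ i, petalWeightDeriv₂ (γ t i) * deriv γ t i ^ 2) / entropySlope (γ t))
      ≤ √((∑ i, (b i - a i) ^ 2 / w t i) / c) := by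
        refine Real.sqrt_le_sqrt (div_le_div₀ ?_ ?_ hcpos hslope)
        · exact Finset.sum_nonneg fun i _ => div_nonneg (sq_nonneg _) (hw0 t ht' i).le
        · refine Finset.sum_le_sum fun i _ => ?_
          rw [← hvel i, ← hγw t ht' i]
          exact petalWeightDeriv₂_mul_sq_le (hγpos t ht' i) _
    _ = 1 / √c * √(∑ i, (b i - a i) ^ 2 / w t i) := by
        rw [Real.sqrt_div' _ hcpos.le]
        ring
    _ ≤ 1 / √c * ∑ i, √((b i - a i) ^ 2 / w t i) := by
        gcongr
        exact sqrt_sum_le_sum_sqrt fun i => div_nonneg (sq_nonneg _) (hw0 t ht' i).le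
    _ ≤ 1 / √c * ∑ i, √|b i - a i| * (1 / √t + 1 / √(1 - t)) := by
        gcongr with i _
        rw [Real.sqrt_div (sq_nonneg _), Real.sqrt_sq_eq_abs]
        exact abs_div_sqrt_le (ha0 i) (hb0 i) ht
    _ = _ := by rw [← Finset.sum_mul, ← mul_assoc]

end Distance

/-! ### Identifying a completion -/

section Completion

variable {M X : Type*} [UniformSpace M] [TopologicalSpace X]

/-- Continuity: the Cauchy filter `𝓝 m` has a limit under `u`, which must be `u m` because `pure m ≤
𝓝 m`. Conversely, the Cauchy filter `comap u (𝓝 (u m))` clusters at `m`, so it converges to `m`. -/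
theorem isInducing_of_cauchy [T2Space X] {u : M → X}
    (h1 : ∀ F : Filter M, Cauchy F → ∃ x, Tendsto u F (𝓝 x))
    (h2 : ∀ m, Cauchy (comap u (𝓝 (u m)))) : IsInducing u := by
  refine isInducing_iff_nhds.2 fun m => le_antisymm ?_ ?_
  · obtain ⟨x, hx⟩ := h1 (𝓝 m) cauchy_nhds
    have : u m = x := tendsto_nhds_unique (tendsto_pure_nhds u m) (hx.mono_left (pure_le_nhds m))
    rw [← tendsto_iff_comap, this]
    exact hx
  · refine le_nhds_of_cauchy_adhp (h2 m) ?_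
    refine ClusterPt.of_le_nhds' (f := pure m) (pure_le_nhds m) inferInstance |>.mono ?_
    exact tendsto_iff_comap.1 (tendsto_pure_nhds u m)

/-- The hypotheses let `u` extend to the completion and the embedding of `M` extend to `X`; the two
extensions are inverse on dense subsets, hence everywhere. -/
theorem exists_completion_homeomorph [T3Space X] {u : M → X} (hd : DenseRange u)
    (h1 : ∀ F : Filter M, Cauchy F → ∃ x, Tendsto u F (𝓝 x))
    (h2 : ∀ x, Cauchy (comap u (𝓝 x))) :
    ∃ Φ : UniformSpace.Completion M ≃ₜ X, ∀ m : M, Φ m = u m := by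
  have hc : IsDenseInducing ((↑) : M → UniformSpace.Completion M) :=
    UniformSpace.Completion.isDenseInducing_coe
  have hu : IsDenseInducing u := ⟨isInducing_of_cauchy h1 fun m => h2 (u m), hd⟩
  have hf : Continuous (hc.extend u) := by
    refine hc.continuous_extend fun p => h1 _ ?_
    have := hc.comap_nhds_neBot p
    exact cauchy_nhds.comap (UniformSpace.Completion.isUniformInducing_coe M).comap_uniformity.le
  have hg : Continuous (hu.extend ((↑) : M → UniformSpace.Completion M)) := by
    refine hu.continuous_extend fun x => ?_
    exact CompleteSpace.complete
      ((h2 x).map (UniformSpace.Completion.uniformContinuous_coe M))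
  have hfc : ∀ m : M, hc.extend u m = u m := hc.extend_eq hu.continuous
  have hgu : ∀ m : M, hu.extend ((↑) : M → UniformSpace.Completion M) (u m) = m :=
    hu.extend_eq hc.continuous
  refine ⟨⟨⟨hc.extend u, hu.extend (↑), fun p => ?_, fun x => ?_⟩, hf, hg⟩, hfc⟩
  · refine congrFun (hc.dense.equalizer (hg.comp hf) continuous_id (funext fun m => ?_)) p
    simp [hfc, hgu]
  · refine congrFun (hu.dense.equalizer (hf.comp hg) continuous_id (funext fun m => ?_)) x
    simp [hfc, hgu]

end Completion

/-! ### The weights of the petals as coordinates -/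

section Weights

variable {ι : Type*}

theorem RoseModuli.ext_len {x y : RoseModuli ι} (h : x.len = y.len) : x = y := by
  cases x
  cases y
  simp_all

/-- The weights of the petals: barycentric coordinates on the moduli space. -/
def RoseModuli.weight (x : RoseModuli ι) : ι → ℝ := fun i => petalWeight (x.len i)

theorem RoseModuli.weight_pos (x : RoseModuli ι) (i : ι) : 0 < x.weight i := petalWeight_pos _

theorem RoseModuli.weight_lt_one (x : RoseModuli ι) (i : ι) : x.weight i < 1 :=
  petalWeight_lt_one (x.isUnitEntropy.1 i)

theorem RoseModuli.weight_injective :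
    Function.Injective (RoseModuli.weight : RoseModuli ι → ι → ℝ) := fun _ _ h =>
  RoseModuli.ext_len (funext fun i => strictAnti_petalWeight.injective (congrFun h i))

theorem weight_eq_one_sub_exp (x : RoseModuli ι) (i : ι) :
    x.weight i = 1 - Real.exp (1 - petalHeight (x.len i) ^ 2) := by
  have h := x.isUnitEntropy.1 i
  rw [petalHeight, Real.sq_sqrt (by linarith [one_le_one_sub_log h]), sub_sub_cancel,
    Real.exp_log (sub_pos.2 (petalWeight_lt_one h))]
  simp [RoseModuli.weight]

variable [Fintype ι]

theorem lt_one_of_mem_simplexWithoutVertices [DecidableEq ι] {p : ι → ℝ}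
    (hp : p ∈ simplexWithoutVertices ι) (i : ι) : p i < 1 := by
  refine lt_of_le_of_ne ((mem_Icc_of_mem_stdSimplex hp.1 i).2) fun h => hp.2 ⟨i, ?_⟩
  have hsum := hp.1.2
  rw [← Finset.add_sum_erase _ _ (Finset.mem_univ i), h, add_eq_left,
    Finset.sum_eq_zero_iff_of_nonneg fun j _ => hp.1.1 j] at hsum
  ext j
  rcases eq_or_ne j i with rfl | hj
  · simp [h]
  · simp [hj, hsum j (Finset.mem_erase.2 ⟨hj, Finset.mem_univ _⟩)]

theorem mem_simplexWithoutVertices [DecidableEq ι] {p : ι → ℝ} (hp : p ∈ stdSimplex ℝ ι)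
    (h : ∀ i, p i < 1) : p ∈ simplexWithoutVertices ι := by
  refine ⟨hp, ?_⟩
  rintro ⟨i, rfl⟩
  simpa using h i

variable [Nontrivial ι]

theorem RoseModuli.weight_mem_stdSimplex (x : RoseModuli ι) : x.weight ∈ stdSimplex ℝ ι :=
  ⟨fun i => (x.weight_pos i).le, (isUnitEntropy_iff.1 x.isUnitEntropy).2⟩

theorem exists_weight_eq {p : ι → ℝ} (h0 : ∀ i, 0 < p i) (h1 : ∑ i, p i = 1) :
    ∃ x : RoseModuli ι, x.weight = p := by
  classical
  have hlt : ∀ i, p i < 1 := by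
    intro i
    obtain ⟨j, hj⟩ := exists_ne i
    have : p i + p j ≤ ∑ k, p k := by
      rw [← Finset.sum_pair hj.symm]
      exact Finset.sum_le_sum_of_subset_of_nonneg (Finset.subset_univ _) fun k _ _ => (h0 k).le
    linarith [h0 j]
  have hw : ∀ i, petalWeight (Real.log ((2 - p i) / p i)) = p i := fun i =>
    petalWeight_log (h0 i) (by linarith [hlt i])
  refine ⟨⟨fun i => Real.log ((2 - p i) / p i), isUnitEntropy_iff.2 ⟨fun i => ?_, ?_⟩⟩,
    funext hw⟩
  · refine Real.log_pos ?_
    rw [one_lt_div (h0 i)]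
    linarith [hlt i]
  · simp only [hw, h1]

theorem mem_closure_range_weight {p : ι → ℝ} (hp : p ∈ stdSimplex ℝ ι) :
    p ∈ closure (range (RoseModuli.weight : RoseModuli ι → ι → ℝ)) := by
  have hn : (0 : ℝ) < Fintype.card ι := by exact_mod_cast Fintype.card_pos
  -- The point is pushed slightly towards the barycentre, which makes all coordinates positive.
  set f : ℝ → ι → ℝ := fun t => (1 - t) • p + t • fun _ => 1 / (Fintype.card ι : ℝ) with hf
  have hlim : Tendsto f (𝓝[>] 0) (𝓝 p) := by
    have hc : Continuous f := by fun_prop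
    have := hc.tendsto 0
    simp only [hf, sub_zero, one_smul, zero_smul, add_zero] at this
    exact this.mono_left nhdsWithin_le_nhds
  refine mem_closure_of_tendsto hlim ?_
  filter_upwards [Ioo_mem_nhdsGT zero_lt_one] with t ht
  refine exists_weight_eq (fun i => ?_) ?_
  · have h1 := mul_nonneg (sub_nonneg.2 ht.2.le) (hp.1 i)
    have h2 : 0 < t * (1 / (Fintype.card ι : ℝ)) := mul_pos ht.1 (by positivity)
    simpa [hf] using add_pos_of_nonneg_of_pos h1 h2
  · simp only [hf, Pi.add_apply, Pi.smul_apply, smul_eq_mul, Finset.sum_add_distrib,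
      ← Finset.mul_sum, hp.2, Finset.sum_const, Finset.card_univ, nsmul_eq_mul]
    field_simp
    ring

theorem comap_weight_neBot {p : ι → ℝ} (hp : p ∈ stdSimplex ℝ ι) :
    NeBot (comap (RoseModuli.weight : RoseModuli ι → ι → ℝ) (𝓝 p)) := by
  refine comap_neBot_iff.2 fun t ht => ?_
  obtain ⟨_, h, x, rfl⟩ := mem_closure_iff_nhds.1 (mem_closure_range_weight hp) t ht
  exact ⟨x, h⟩

/-- The Lipschitz heights converge to finite limits along a Cauchy filter, and a finite height means
a weight strictly below one. -/
theorem exists_tendsto_weight {F : Filter (RoseModuli ι)} (hF : Cauchy F) :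
    ∃ p ∈ stdSimplex ℝ ι, (∀ i, p i < 1) ∧ Tendsto RoseModuli.weight F (𝓝 p) := by
  have := hF.1
  choose c hc using fun i =>
    CompleteSpace.complete (hF.map (lipschitzWith_petalHeight i).uniformContinuous)
  have hlim : Tendsto RoseModuli.weight F (𝓝 fun i => 1 - Real.exp (1 - c i ^ 2)) := by
    refine tendsto_pi_nhds.2 fun i => ?_
    have hcont : Continuous fun h : ℝ => 1 - Real.exp (1 - h ^ 2) := by fun_prop
    exact ((hcont.tendsto (c i)).comp (hc i)).congr fun x => (weight_eq_one_sub_exp x i).symm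
  refine ⟨_, ?_, fun i => sub_lt_self _ (Real.exp_pos _), hlim⟩
  exact (isClosed_stdSimplex ℝ ι).mem_of_tendsto hlim
    (Eventually.of_forall RoseModuli.weight_mem_stdSimplex)

theorem exists_pos_lt_one_sub {p : ι → ℝ} (h : ∀ i, p i < 1) : ∃ δ > 0, ∀ i, p i < 1 - δ := by
  obtain ⟨i, hi⟩ := Finite.exists_max p
  have := h i
  exact ⟨(1 - p i) / 2, by linarith, fun j => by linarith [hi j]⟩

theorem cauchy_comap_weight {p : ι → ℝ} (hp : p ∈ stdSimplex ℝ ι) (h : ∀ i, p i < 1) :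
    Cauchy (comap (RoseModuli.weight : RoseModuli ι → ι → ℝ) (𝓝 p)) := by
  refine EMetric.cauchy_iff.2 ⟨(comap_weight_neBot hp).ne, fun ε hε => ?_⟩
  obtain ⟨δ, hδ, hlt⟩ := exists_pos_lt_one_sub h
  obtain ⟨C, hC, hdist⟩ := exists_edist_le (ι := ι) hδ
  have hcont : Continuous fun q : (ι → ℝ) × (ι → ℝ) => ∑ i, √|q.2 i - q.1 i| := by fun_prop
  have hlim : Tendsto (fun q : (ι → ℝ) × (ι → ℝ) => C * ENNReal.ofReal (∑ i, √|q.2 i - q.1 i|))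
      (𝓝 p ×ˢ 𝓝 p) (𝓝 0) := by
    have h1 := ENNReal.tendsto_ofReal (hcont.tendsto (p, p))
    simp only [sub_self, abs_zero, Real.sqrt_zero, Finset.sum_const_zero,
      ENNReal.ofReal_zero] at h1
    rw [← nhds_prod_eq]
    simpa using ENNReal.Tendsto.const_mul h1 (Or.inr hC)
  obtain ⟨t, ht, htε⟩ := mem_prod_same_iff.1 (hlim.eventually (gt_mem_nhds hε))
  have hK : {q : ι → ℝ | ∀ i, q i < 1 - δ} ∈ 𝓝 p := by
    have : IsOpen {q : ι → ℝ | ∀ i, q i < 1 - δ} := by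
      simp only [ofPred_forall]
      exact isOpen_iInter_of_finite fun i => isOpen_lt (continuous_apply i) continuous_const
    exact this.mem_nhds hlt
  refine ⟨RoseModuli.weight ⁻¹' (t ∩ {q | ∀ i, q i < 1 - δ}),
    preimage_mem_comap (inter_mem ht hK), fun x hx y hy => ?_⟩
  exact (hdist x y (fun i => (hx.2 i).le) fun i => (hy.2 i).le).trans_lt
    (htε (mk_mem_prod hx.1 hy.1))

theorem isInducing_weight : IsInducing (RoseModuli.weight : RoseModuli ι → ι → ℝ) := by
  refine isInducing_of_cauchy (fun F hF => ?_)
    fun m => cauchy_comap_weight m.weight_mem_stdSimplex m.weight_lt_one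
  obtain ⟨p, _, _, h⟩ := exists_tendsto_weight hF
  exact ⟨p, h⟩

theorem exists_completion_homeomorph_simplex [DecidableEq ι] :
    ∃ Φ : RoseModuliCompletion ι ≃ₜ simplexWithoutVertices ι,
      ∀ x : RoseModuli ι, (Φ x : ι → ℝ) = x.weight := by
  set u : RoseModuli ι → simplexWithoutVertices ι := fun x =>
    ⟨x.weight, mem_simplexWithoutVertices x.weight_mem_stdSimplex x.weight_lt_one⟩ with hu
  have hcomap : ∀ p, comap u (𝓝 p) = comap RoseModuli.weight (𝓝 (p : ι → ℝ)) := fun p => by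
    rw [nhds_subtype_eq_comap, comap_comap]
    rfl
  have hdense : DenseRange u := fun p => mem_closure_iff_nhds.2 fun t ht => by
    have := comap_weight_neBot p.2.1
    rw [← hcomap] at this
    obtain ⟨x, hx⟩ := comap_neBot_iff.1 this t ht
    exact ⟨u x, hx, mem_range_self x⟩
  obtain ⟨Φ, hΦ⟩ := exists_completion_homeomorph hdense
    (fun F hF => by
      obtain ⟨p, hp, hp1, h⟩ := exists_tendsto_weight hF
      exact ⟨⟨p, mem_simplexWithoutVertices hp hp1⟩, tendsto_subtype_rng.2 h⟩)
    fun p => by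
      rw [hcomap]
      exact cauchy_comap_weight p.2.1 (lt_one_of_mem_simplexWithoutVertices p.2)
  exact ⟨Φ, fun x => by rw [hΦ]⟩

theorem RoseModuli.edist_ne_top (x y : RoseModuli ι) : edist x y ≠ ⊤ := by
  obtain ⟨δ, hδ, hx⟩ := exists_pos_lt_one_sub x.weight_lt_one
  obtain ⟨δ', hδ', hy⟩ := exists_pos_lt_one_sub y.weight_lt_one
  obtain ⟨C, hC, h⟩ := exists_edist_le (ι := ι) (lt_min hδ hδ')
  refine ne_top_of_le_ne_top (ENNReal.mul_ne_top hC ENNReal.ofReal_ne_top) (h x y ?_ ?_)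
  · exact fun i => (hx i).le.trans (sub_le_sub_left (min_le_left _ _) _)
  · exact fun i => (hy i).le.trans (sub_le_sub_left (min_le_right _ _) _)

theorem RoseModuli.eq_of_edist_eq_zero {x y : RoseModuli ι} (h : edist x y = 0) : x = y :=
  RoseModuli.weight_injective
    ((EMetric.inseparable_iff.2 h).map isInducing_weight.continuous).eq

end Weights

/-! ### Convergence of the weights -/

theorem tendsto_petalWeight_comp_nhds_iff {α : Type*} {F : Filter α} {f : α → ℝ} {a : ℝ} :
    Tendsto (fun n => petalWeight (f n)) F (𝓝 (petalWeight a)) ↔ Tendsto f F (𝓝 a) := by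
  refine ⟨fun h => ?_, fun h => (continuous_petalWeight.tendsto a).comp h⟩
  have hpos := petalWeight_pos a
  have hlt := petalWeight_lt_two a
  have hc : ContinuousAt (fun u : ℝ => Real.log ((2 - u) / u)) (petalWeight a) := by
    refine ContinuousAt.log ?_ (div_pos (by linarith) hpos).ne'
    exact (continuousAt_const.sub continuousAt_id).div continuousAt_id hpos.ne'
  simpa only [Function.comp_def, log_two_sub_petalWeight_div] using hc.tendsto.comp h

theorem tendsto_petalWeight_comp_zero_iff {α : Type*} {F : Filter α} {f : α → ℝ} :
    Tendsto (fun n => petalWeight (f n)) F (𝓝 0) ↔ Tendsto f F atTop := by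
  refine ⟨fun h => tendsto_atTop.2 fun b => ?_, fun h => tendsto_petalWeight_atTop.comp h⟩
  filter_upwards [h.eventually (gt_mem_nhds (petalWeight_pos b))] with n hn
  exact (strictAnti_petalWeight.lt_iff_gt.1 hn).le

/-! ### The faces of the simplex -/

section Faces

variable {ι : Type*} [DecidableEq ι]

/-- The weights of the petals of a subrose, extended by zero. -/
def faceWeight (S : Finset ι) (m : RoseModuli S) : ι → ℝ :=
  fun i => if h : i ∈ S then m.weight ⟨i, h⟩ else 0

theorem faceWeight_of_mem {S : Finset ι} (m : RoseModuli S) {i : ι} (h : i ∈ S) :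
    faceWeight S m i = m.weight ⟨i, h⟩ := dif_pos h

theorem faceWeight_of_notMem {S : Finset ι} (m : RoseModuli S) {i : ι} (h : i ∉ S) :
    faceWeight S m i = 0 := dif_neg h

theorem faceWeight_pos_iff {S : Finset ι} (m : RoseModuli S) (i : ι) :
    0 < faceWeight S m i ↔ i ∈ S := by
  by_cases h : i ∈ S
  · simp [faceWeight_of_mem m h, h, m.weight_pos]
  · simp [faceWeight_of_notMem m h, h]

/-- Restricting to the coordinates in `S` recovers the weights of the subrose, which already induce
its topology. -/
theorem isInducing_faceWeight {S : Finset ι} [Nontrivial S] : IsInducing (faceWeight S) := by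
  have hcont : Continuous (faceWeight S) := by
    refine continuous_pi fun i => ?_
    by_cases h : i ∈ S
    · simp only [faceWeight_of_mem _ h]
      exact (continuous_apply _).comp isInducing_weight.continuous
    · simp only [faceWeight_of_notMem _ h]
      exact continuous_const
  refine IsInducing.of_comp (g := fun (p : ι → ℝ) (i : S) => p i) hcont (by fun_prop) ?_
  convert (isInducing_weight : IsInducing (RoseModuli.weight : RoseModuli S → S → ℝ)) using 1
  ext m i
  exact faceWeight_of_mem m i.2

variable [Fintype ι] {S : Finset ι} [Nontrivial S]

theorem faceWeight_mem_simplexWithoutVertices (m : RoseModuli S) :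
    faceWeight S m ∈ simplexWithoutVertices ι := by
  refine mem_simplexWithoutVertices ⟨fun i => ?_, ?_⟩ fun i => ?_
  · by_cases h : i ∈ S
    · exact ((faceWeight_pos_iff m i).2 h).le
    · exact (faceWeight_of_notMem m h).ge
  · rw [← Finset.sum_subset (Finset.subset_univ S) fun i _ h => faceWeight_of_notMem m h,
      ← Finset.sum_coe_sort, ← m.weight_mem_stdSimplex.2]
    exact Finset.sum_congr rfl fun i _ => faceWeight_of_mem m i.2
  · by_cases h : i ∈ S
    · rw [faceWeight_of_mem m h]
      exact m.weight_lt_one _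
    · rw [faceWeight_of_notMem m h]
      exact one_pos

theorem exists_homeomorph_face
    (Φ : RoseModuliCompletion ι ≃ₜ simplexWithoutVertices ι) :
    ∃ Ψ : RoseModuli S ≃ₜ
        {p : RoseModuliCompletion ι // ∀ i, 0 < (Φ p : ι → ℝ) i ↔ i ∈ S},
      ∀ m, (Φ (Ψ m).1 : ι → ℝ) = faceWeight S m := by
  set e : RoseModuli S → simplexWithoutVertices ι := fun m =>
    ⟨faceWeight S m, faceWeight_mem_simplexWithoutVertices m⟩ with he
  set f : RoseModuli S → {p : RoseModuliCompletion ι // ∀ i, 0 < (Φ p : ι → ℝ) i ↔ i ∈ S} :=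
    fun m => ⟨Φ.symm (e m), fun i => by
      rw [Φ.apply_symm_apply]
      exact faceWeight_pos_iff m i⟩ with hf
  have hΦf : ∀ m, (Φ (f m).1 : ι → ℝ) = faceWeight S m := fun m => by
    simp only [hf, Φ.apply_symm_apply, he]
  have hbij : Function.Bijective f := by
    constructor
    · intro m m' h
      refine RoseModuli.weight_injective (funext fun i => ?_)
      rw [← faceWeight_of_mem m i.2, ← faceWeight_of_mem m' i.2, ← hΦf, ← hΦf, h]
    · rintro ⟨p, hp⟩
      have hzero : ∀ i ∉ S, (Φ p : ι → ℝ) i = 0 := fun i hi =>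
        le_antisymm (not_lt.1 fun h => hi ((hp i).1 h)) ((Φ p).2.1.1 i)
      obtain ⟨m, hm⟩ := exists_weight_eq (ι := S) (p := fun i => (Φ p : ι → ℝ) i)
        (fun i => (hp i).2 i.2) (by
          rw [Finset.sum_coe_sort S fun i => (Φ p : ι → ℝ) i,
            Finset.sum_subset (Finset.subset_univ S) fun i _ h => hzero i h]
          exact (Φ p).2.1.2)
      refine ⟨m, Subtype.ext (Φ.injective (Subtype.ext ?_))⟩
      rw [hΦf]
      ext i
      by_cases h : i ∈ S
      · rw [faceWeight_of_mem m h, hm]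
      · rw [faceWeight_of_notMem m h, hzero i h]
  have hind : IsInducing f := by
    refine (IsInducing.subtypeVal.of_comp_iff).1 ?_
    exact Φ.symm.isInducing.comp (IsInducing.subtypeVal.of_comp_iff.1 isInducing_faceWeight)
  exact ⟨(Equiv.ofBijective f hbij).toHomeomorphOfIsInducing hind, hΦf⟩

end Faces

end

/-! ### Assembly of the main theorem. -/

theorem theorem1p2 (r : ℕ) (hr : 2 ≤ r) :
    -- the limit that defines the entropy exists for every length function
    (∀ ℓ : Fin r → ℝ, (∀ i, 0 < ℓ i) →
      Tendsto (fun t : ℝ => 1 / t * Real.log (roseCircuitCount ℓ t)) atTop (𝓝 (roseEntropy ℓ))) ∧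
    -- the entropy distance is finite and separates points
    (∀ x y : RoseModuli (Fin r), edist x y ≠ ⊤ ∧ (edist x y = 0 → x = y)) ∧
    -- the completion is a simplex without its vertices
    ∃ Φ : RoseModuliCompletion (Fin r) ≃ₜ simplexWithoutVertices (Fin r),
      -- the moduli space itself is the interior of the simplex
      (∀ p : RoseModuliCompletion (Fin r),
        p ∈ range ((↑) : RoseModuli (Fin r) → RoseModuliCompletion (Fin r)) ↔
          ∀ i, 0 < (Φ p : Fin r → ℝ) i) ∧
      -- the open face spanned by `S` is the moduli space of the subrose with petals `S`
      ∀ S : Finset (Fin r), 2 ≤ S.card →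
        ∃ Ψ : RoseModuli S ≃ₜ
            {p : RoseModuliCompletion (Fin r) // ∀ i, 0 < (Φ p : Fin r → ℝ) i ↔ i ∈ S},
          ∀ (m : RoseModuli S) (x : ℕ → RoseModuli (Fin r)),
            Tendsto (fun n => (x n : RoseModuliCompletion (Fin r))) atTop (𝓝 (Ψ m).1) ↔
              (∀ i : S, Tendsto (fun n => (x n).len i) atTop (𝓝 (m.len i))) ∧
              ∀ i ∉ S, Tendsto (fun n => (x n).len i) atTop atTop := by
  have : Nontrivial (Fin r) := Fin.nontrivial_iff_two_le.2 hr
  obtain ⟨Φ, hΦ⟩ := exists_completion_homeomorph_simplex (ι := Fin r)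
  refine ⟨fun ℓ hℓ => tendsto_roseEntropy hℓ,
    fun x y => ⟨x.edist_ne_top y, RoseModuli.eq_of_edist_eq_zero⟩, Φ, fun p => ⟨?_, fun h => ?_⟩,
    fun S hS => ?_⟩
  · rintro ⟨x, rfl⟩ i
    rw [hΦ]
    exact x.weight_pos i
  · obtain ⟨x, hx⟩ := exists_weight_eq h (Φ p).2.1.2
    exact ⟨x, Φ.injective (Subtype.ext ((hΦ x).trans hx))⟩
  · have : Nontrivial S := Fintype.one_lt_card_iff_nontrivial.1 (by simpa using Nat.succ_le_iff.1 hS)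
    obtain ⟨Ψ, hΨ⟩ := exists_homeomorph_face (S := S) Φ
    refine ⟨Ψ, fun m x => ?_⟩
    rw [Φ.isInducing.tendsto_nhds_iff, IsInducing.subtypeVal.tendsto_nhds_iff, hΨ,
      tendsto_pi_nhds]
    simp only [Function.comp_def, hΦ]
    have hmem : ∀ i (h : i ∈ S), Tendsto (fun n => (x n).weight i) atTop (𝓝 (faceWeight S m i)) ↔
        Tendsto (fun n => (x n).len i) atTop (𝓝 (m.len ⟨i, h⟩)) := fun i h => by
      rw [faceWeight_of_mem m h]
      exact tendsto_petalWeight_comp_nhds_iff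
    have hnot : ∀ i ∉ S, (Tendsto (fun n => (x n).weight i) atTop (𝓝 (faceWeight S m i)) ↔
        Tendsto (fun n => (x n).len i) atTop atTop) := fun i h => by
      rw [faceWeight_of_notMem m h]
      exact tendsto_petalWeight_comp_zero_iff
    refine ⟨fun h => ⟨fun i => (hmem i i.2).1 (h i), fun i hi => (hnot i hi).1 (h i)⟩,
      fun h i => ?_⟩
    by_cases hi : i ∈ S
    · exact (hmem i hi).2 (h.1 ⟨i, hi⟩)
    · exact (hnot i hi).2 (h.2 i hi)
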